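/- **Setting.** Let $N\ge 1$, let $\Xi$ be a finite set of scenarios $\xi=(\xi_{[1]},\dots,\xi_{[N]})$ with probabilities $\pi(\xi)>0$, $\sum_{\xi\in\Xi}\pi(\xi)=1$, and let $\mathbb R^d=\mathbb R^{d_1}\times\cdots\times\mathbb R^{d_N}$ with its $\ell^2$ scalar product. Let $\mathcal H$ be the space of all maps $x\colon\Xi\to\mathbb R^d$, $\xi\mapsto(x_{[1]}(\xi),\dots,x_{[N]}(\xi))$, with scalar product $\langle x,y\rangle_{\mathcal H}=\sum_{\xi\in\Xi}\pi(\xi)\langle x(\xi),y(\xi)\rangle_2$. Let $\mathcal V\subset\mathcal H$ be the nonanticipativity subspace, i.e. the set of all $x\in\mathcal H$ such that, for every $k\in\{1,\dots,N\}$ and all $\xi,\eta\in\Xi$ with $(\xi_{[1]},\dots,\xi_{[k-1]})=(\eta_{[1]},\dots,\eta_{[k-1]})$, one has $x_{[k]}(\xi)=x_{[k]}(\eta)$. For every $\xi\in\Xi$ let $A(\xi,\cdot)\colon\mathbb R^d\to 2^{\mathbb R^d}$ be maximally monotone and let $C(\xi)\subset\mathbb R^d$ be nonempty, closed and convex, with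 normal cone operator $N_{C(\xi)}$. Consider the problem $$\text{find } x\in\mathcal V \text{ and } v^*\in\mathcal V^\perp \text{ such that } (\forall \xi\in\Xi)\quad -v^*(\xi)\in A(\xi,x(\xi))+N_{C(\xi)}x(\xi), \qquad (1)$$ and assume that it has a solution. Write $J_T=(\mathrm{Id}+T)^{-1}$ for the resolvent of a maximally monotone operator $T$ and $\mathrm{proj}_D$ for the projector onto $D$. **Parameters.** Let $(\Xi_n)_{n\in\mathbb N}$ be nonempty subsets of $\Xi$ such that $\Xi_0=\Xi$ and, for some $m\in\mathbb N$, $\bigcup_{j=n}^{n+m}\Xi_j=\Xi$ for every $n\in\mathbb N$. Let $\varepsilon\in\,]0,1[$ and, for all $\xi\in\Xi$ and $n\in\mathbb N$, let $\gamma_{\xi,n},\mu_{\xi,n}\in[\varepsilon,1/\varepsilon]$. Let $(U(\xi))_{\xi\in\Xi}$ be vector subspaces of $\mathbb R^d$ with $\operatorname{ran}(\mathrm{Id}-\mathrm{proj}_{C(\xi)})\subset U(\xi)$ for every $\xi\in\Xi$. Let $x_0\in\mathcal V$, $v_0^*\in\mathcal V^\perp$, and $x_0^*\in\mathcal H$ with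 $x_0^*(\xi)\in U(\xi)$ for every $\xi\in\Xi$. **Algorithm.** For $n=0,1,\dots$: - for every $\xi\in\Xi_n$, set $l_n^*(\xi)=x_n^*(\xi)+v_n^*(\xi)$, $a_n(\xi)=J_{\gamma_{\xi,n}A(\xi,\cdot)}(x_n(\xi)-\gamma_{\xi,n}l_n^*(\xi))$, $a_n^*(\xi)=\gamma_{\xi,n}^{-1}(x_n(\xi)-a_n(\xi))-l_n^*(\xi)$, $b_n(\xi)=\mathrm{proj}_{C(\xi)}(x_n(\xi)+\mu_{\xi,n}x_n^*(\xi))$, $b_n^*(\xi)=x_n^*(\xi)+\mu_{\xi,n}^{-1}(x_n(\xi)-b_n(\xi))$, $u_n(\xi)=\mathrm{proj}_{U(\xi)}(b_n(\xi)-a_n(\xi))$; - for every $\xi\in\Xi\smallsetminus\Xi_n$, set $(a_n,a_n^*,b_n,b_n^*,u_n)(\xi)=(a_{n-1},a_{n-1}^*,b_{n-1},b_{n-1}^*,u_{n-1})(\xi)$; - set $t_n^*=\mathrm{proj}_{\mathcal V}(a_n^*+b_n^*)$, $t_n=-\mathrm{proj}_{\mathcal V^\perp}a_n$ and $\tau_n=\|t_n^*\|_{\mathcal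 H}^2+\|u_n\|_{\mathcal H}^2+\|t_n\|_{\mathcal H}^2$; - if $\tau_n>0$, set $\kappa_n=\langle x_n,t_n^*\rangle_{\mathcal H}-\langle a_n,a_n^*\rangle_{\mathcal H}+\langle u_n,x_n^*\rangle_{\mathcal H}-\langle b_n,b_n^*\rangle_{\mathcal H}+\langle t_n,v_n^*\rangle_{\mathcal H}$, choose $\lambda_n\in[\varepsilon,2-\varepsilon]$, and set $\theta_n=\lambda_n\max\{\kappa_n,0\}/\tau_n$; otherwise set $\theta_n=0$; - set $x_{n+1}=x_n-\theta_nt_n^*$, $x_{n+1}^*=x_n^*-\theta_nu_n$, $v_{n+1}^*=v_n^*-\theta_nt_n$. **Theorem.** There exists a solution $(\overline x,\overline v^*)\in\mathcal V\times\mathcal V^\perp$ of (1) such that $x_n\to\overline x$ and $v_n^*\to\overline v^*$ in $\mathcal H$. Furthermore, $x_n\in\mathcal V$ and $v_n^*\in\mathcal V^\perp$ for every $n\in\mathbb N$. -/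

import Mathlib

open Filter Topology
open scoped Pointwise InnerProductSpace

noncomputable section

namespace StochEq

/-! ## Monotone operators and projections on a real inner product space -/

section Operators

variable {E : Type*} [NormedAddCommGroup E] [InnerProductSpace ℝ E]

/-- A set-valued operator `T : E → 2^E` is monotone. -/
def IsMonotoneOp (T : E → Set E) : Prop :=
  ∀ x y : E, ∀ u ∈ T x, ∀ v ∈ T y, 0 ≤ ⟪x - y, u - v⟫_ℝ

/-- A set-valued operator is maximally monotone. -/
def IsMaximallyMonotone (T : E → Set E) : Prop :=
  IsMonotoneOp T ∧
    ∀ x u : E, (∀ y : E, ∀ v ∈ T y, 0 ≤ ⟪x - y, u - v⟫_ℝ) → u ∈ T x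

/-- The resolvent `(Id + T)⁻¹`, as a map: `resolvent T y` is the point `p` with `y ∈ p + T p`.
For a maximally monotone `T` on a complete space such a `p` exists and is unique. -/
def resolvent (T : E → Set E) (y : E) : E :=
  Classical.epsilon fun p : E => y ∈ ({p} : Set E) + T p

/-- The projector onto a nonempty closed convex set `C`: `projSet C y` is the point of `C` closest
to `y` (which exists and is unique when `E` is complete). -/
def projSet (C : Set E) (y : E) : E :=
  Classical.epsilon fun p : E => p ∈ C ∧ ∀ z ∈ C, ‖y - p‖ ≤ ‖y - z‖

/-- The normal cone operator of `C`, that is, the subdifferential of the indicator function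
of `C`; it is empty at the points outside `C`. -/
def normalCone (C : Set E) (x : E) : Set E :=
  {u | x ∈ C ∧ ∀ z ∈ C, ⟪z - x, u⟫_ℝ ≤ 0}

end Operators

/-! ## The multi-stage decision model -/

universe u

/-- An `N`-stage decision process. Stages are numbered `0, …, N - 1`. A scenario is a tuple
`ξ = (ξ 0, …, ξ (N - 1))`, where `ξ k` is revealed after decision `k` and before
decision `k + 1`. The finite set of scenarios carries strictly positive probabilities, and the
decision at stage `k` is a vector with `d k` real coordinates. -/
structure DecisionModel where
  N : ℕ
  N_pos : 0 < N
  Info : Fin N → Type u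
  scenarios : Finset ((k : Fin N) → Info k)
  prob : scenarios → ℝ
  prob_pos : ∀ ξ, 0 < prob ξ
  prob_sum : ∑ ξ, prob ξ = 1
  d : Fin N → ℕ

namespace DecisionModel

variable (M : DecisionModel.{u})

/-- The set of scenarios, as a (finite) type. -/
abbrev Scenario : Type u := M.scenarios

/-- The space `ℝ^d = ℝ^{d_1} × ⋯ × ℝ^{d_N}` with the `ℓ²` scalar product. -/
abbrev Decision : Type := PiLp 2 fun k : Fin M.N => EuclideanSpace ℝ (Fin (M.d k))

/-- The space `ℋ` of all maps from scenarios to decision vectors. -/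
def Policy : Type u := M.Scenario → M.Decision

instance : AddCommGroup M.Policy := inferInstanceAs (AddCommGroup (M.Scenario → M.Decision))

instance : Module ℝ M.Policy := inferInstanceAs (Module ℝ (M.Scenario → M.Decision))

instance : FiniteDimensional ℝ M.Policy :=
  inferInstanceAs (FiniteDimensional ℝ (M.Scenario → M.Decision))

/-- The expectation scalar product `∑ ξ, π(ξ) ⟨x(ξ), y(ξ)⟩` on `ℋ`. -/
abbrev expectationCore : InnerProductSpace.Core ℝ M.Policy where
  inner x y := ∑ ξ : M.Scenario, M.prob ξ * ⟪x ξ, y ξ⟫_ℝ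
  conj_inner_symm x y := by
    simp only [conj_trivial]
    exact Finset.sum_congr rfl fun ξ _ => by rw [real_inner_comm]
  re_inner_nonneg x :=
    Finset.sum_nonneg fun ξ _ => mul_nonneg (M.prob_pos ξ).le real_inner_self_nonneg
  add_left x y z := by
    rw [← Finset.sum_add_distrib]
    refine Finset.sum_congr rfl fun ξ _ => ?_
    rw [← mul_add, ← inner_add_left]
    rfl
  smul_left x y r := by
    simp only [conj_trivial]
    rw [Finset.mul_sum]
    refine Finset.sum_congr rfl fun ξ _ => ?_
    have h : (r • x) ξ = r • x ξ := rfl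
    rw [h, real_inner_smul_left, mul_left_comm]
  definite x h := by
    have h' := (Finset.sum_eq_zero_iff_of_nonneg fun ξ _ =>
      mul_nonneg (M.prob_pos ξ).le real_inner_self_nonneg).1 h
    funext ξ
    have h1 := h' ξ (Finset.mem_univ ξ)
    exact inner_self_eq_zero.1 ((mul_eq_zero.1 h1).resolve_left (M.prob_pos ξ).ne')

/-- The norm (and the topology) of `ℋ` is the one of the expectation scalar product. -/
instance : NormedAddCommGroup M.Policy := M.expectationCore.toNormedAddCommGroup

instance : InnerProductSpace ℝ M.Policy := InnerProductSpace.ofCore M.expectationCore.toCore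

/-- Two scenarios are information-equivalent at stage `k` if they agree on everything that has been
revealed before the decision at stage `k` is made. -/
def InfoEquiv (k : Fin M.N) (ξ η : M.Scenario) : Prop :=
  ∀ j : Fin M.N, j < k → ξ.1 j = η.1 j

/-- The nonanticipativity subspace `𝒱`: at every stage `k`, the decision is constant on the classes
of information-equivalent scenarios. -/
def nonanticipativity : Submodule ℝ M.Policy where
  carrier := {x | ∀ k : Fin M.N, ∀ ξ η : M.Scenario, M.InfoEquiv k ξ η → x ξ k = x η k}
  add_mem' {x y} hx hy k ξ η h := by
    change x ξ k + y ξ k = x η k + y η k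
    rw [hx k ξ η h, hy k ξ η h]
  zero_mem' _ _ _ _ := rfl
  smul_mem' c x hx k ξ η h := by
    change c • x ξ k = c • x η k
    rw [hx k ξ η h]

/-- `(x, v)` solves the multi-stage stochastic equilibrium problem. -/
def IsSolution (A : M.Scenario → M.Decision → Set M.Decision) (C : M.Scenario → Set M.Decision)
    (x v : M.Policy) : Prop :=
  x ∈ M.nonanticipativity ∧ v ∈ M.nonanticipativityᗮ ∧
    ∀ ξ, -v ξ ∈ A ξ (x ξ) + normalCone (C ξ) (x ξ)

/-- The sequences produced by the block-activated algorithm. The letter `s` at the end of a name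
stands for the star of the corresponding dual variable; `lam` is the relaxation parameter. -/
structure Trajectory where
  (x xs vs ls a as b bs u ts t : ℕ → M.Policy)
  (τ κ lam θ : ℕ → ℝ)

variable {M}

/-- The sequences of `s` satisfy the recursion of the block-activated algorithm, with activated
blocks `Blk n` and parameters `γ`, `μ`, `ε`. At `n = 0` all scenarios are going to be activated, so
the rule for the scenarios that are not activated is needed only from `n = 1` on. -/
structure Trajectory.IsRun (s : Trajectory M)
    (A : M.Scenario → M.Decision → Set M.Decision) (C : M.Scenario → Set M.Decision)
    (U : M.Scenario → Submodule ℝ M.Decision) (Blk : ℕ → Set M.Scenario)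
    (ε : ℝ) (γ μ : M.Scenario → ℕ → ℝ) : Prop where
  ls_eq : ∀ n, ∀ ξ ∈ Blk n, s.ls n ξ = s.xs n ξ + s.vs n ξ
  a_eq : ∀ n, ∀ ξ ∈ Blk n,
    s.a n ξ = resolvent (fun p => γ ξ n • A ξ p) (s.x n ξ - γ ξ n • s.ls n ξ)
  as_eq : ∀ n, ∀ ξ ∈ Blk n, s.as n ξ = (γ ξ n)⁻¹ • (s.x n ξ - s.a n ξ) - s.ls n ξ
  b_eq : ∀ n, ∀ ξ ∈ Blk n, s.b n ξ = projSet (C ξ) (s.x n ξ + μ ξ n • s.xs n ξ)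
  bs_eq : ∀ n, ∀ ξ ∈ Blk n, s.bs n ξ = s.xs n ξ + (μ ξ n)⁻¹ • (s.x n ξ - s.b n ξ)
  u_eq : ∀ n, ∀ ξ ∈ Blk n, s.u n ξ = (U ξ).starProjection (s.b n ξ - s.a n ξ)
  keep : ∀ n, ∀ ξ ∉ Blk (n + 1),
    s.a (n + 1) ξ = s.a n ξ ∧ s.as (n + 1) ξ = s.as n ξ ∧
    s.b (n + 1) ξ = s.b n ξ ∧ s.bs (n + 1) ξ = s.bs n ξ ∧ s.u (n + 1) ξ = s.u n ξ
  ts_eq : ∀ n, s.ts n = M.nonanticipativity.starProjection (s.as n + s.bs n)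
  t_eq : ∀ n, s.t n = -M.nonanticipativityᗮ.starProjection (s.a n)
  τ_eq : ∀ n, s.τ n = ‖s.ts n‖ ^ 2 + ‖s.u n‖ ^ 2 + ‖s.t n‖ ^ 2
  κ_eq : ∀ n, 0 < s.τ n → s.κ n =
    ⟪s.x n, s.ts n⟫_ℝ - ⟪s.a n, s.as n⟫_ℝ + ⟪s.u n, s.xs n⟫_ℝ - ⟪s.b n, s.bs n⟫_ℝ
      + ⟪s.t n, s.vs n⟫_ℝ
  lam_mem : ∀ n, 0 < s.τ n → s.lam n ∈ Set.Icc ε (2 - ε)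
  θ_eq : ∀ n, 0 < s.τ n → s.θ n = s.lam n * max (s.κ n) 0 / s.τ n
  θ_eq_zero : ∀ n, ¬ 0 < s.τ n → s.θ n = 0
  x_succ : ∀ n, s.x (n + 1) = s.x n - s.θ n • s.ts n
  xs_succ : ∀ n, s.xs (n + 1) = s.xs n - s.θ n • s.u n
  vs_succ : ∀ n, s.vs (n + 1) = s.vs n - s.θ n • s.t n

end DecisionModel

end StochEq

end

/-! Splitting the inclusion as `-(x* + v*) ∈ A x`, `x* ∈ N_C x` turns solutions into points of the
Kuhn–Tucker set `Z` in the space of triples `(x, x*, v*)`. The algorithm is a relaxed projection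
method for finding a point of `Z`.

Each `(a, a*)` lies in the graph of `A` and each `(b, b*)` in that of the normal cone, even when
computed at an earlier step. Monotonicity therefore puts `Z` in the half-space of all `z` with `κ_n
≤ ⟪p_n - z, w_n⟫`, where `p_n` is the current triple and `w_n = (t*_n, u_n, t_n)` (`gap_le`). The
update moves `p_n` towards that half-space, so `p_n` is Fejér monotone with respect to `Z`. Hence it
is bounded, its increments vanish, and `max κ_n 0 → 0` once the directions are known to be bounded.

Delays are at most `m`, so data from the last activation differ from current data by a vanishing
amount. Up to such an error, `κ_n` is the expectation of the squared residuals `c⁻¹ ‖x - a‖² + e⁻¹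
‖x - b‖²` (`gap_eq_sum`, `tendsto_inner_sub_residual`). These residuals are nonnegative, so they
vanish (`tendsto_proximal`). Closedness of the graphs puts every cluster point in `Z`, and Fejér
monotonicity upgrades this to convergence.

The resolvent is defined by choice, so its defining inclusion rests on Minty's theorem, obtained
here from Sion's minimax theorem and compactness. -/

noncomputable section

namespace StochEq

/-! ### Minty's theorem, resolvents and normal cones. -/

section OperatorTheory

variable {E : Type*} [NormedAddCommGroup E] [InnerProductSpace ℝ E]

/-- A convex combination of monotonically related pairs `(y i, v i)` has nonnegative covariance. -/
lemma inner_centerOfMass_le {ι : Type*} [Fintype ι] (w : ι → ℝ) (hw : ∀ i, 0 ≤ w i)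
    (hw1 : ∑ i, w i = 1) (y v : ι → E) (h : ∀ i j, 0 ≤ ⟪y i - y j, v i - v j⟫_ℝ) :
    ⟪∑ i, w i • y i, ∑ i, w i • v i⟫_ℝ ≤ ∑ i, w i * ⟪y i, v i⟫_ℝ := by
  have h1 : 0 ≤ ∑ i, ∑ j, w i * w j * ⟪y i - y j, v i - v j⟫_ℝ :=
    Finset.sum_nonneg fun i _ => Finset.sum_nonneg fun j _ =>
      mul_nonneg (mul_nonneg (hw i) (hw j)) (h i j)
  have h2 : ∑ i, ∑ j, w i * w j * ⟪y i - y j, v i - v j⟫_ℝ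
      = ∑ i, ∑ j, (w j * (w i * ⟪y i, v i⟫_ℝ) + w i * (w j * ⟪y j, v j⟫_ℝ)
          - w i * w j * ⟪y i, v j⟫_ℝ - w j * w i * ⟪y j, v i⟫_ℝ) := by
    refine Finset.sum_congr rfl fun i _ => Finset.sum_congr rfl fun j _ => ?_
    rw [inner_sub_left, inner_sub_right, inner_sub_right]
    ring
  have h3 : ⟪∑ i, w i • y i, ∑ i, w i • v i⟫_ℝ = ∑ i, ∑ j, w i * w j * ⟪y i, v j⟫_ℝ := by
    rw [sum_inner]
    refine Finset.sum_congr rfl fun i _ => ?_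
    rw [inner_sum]
    refine Finset.sum_congr rfl fun j _ => ?_
    rw [real_inner_smul_left, real_inner_smul_right, mul_assoc]
  have h4 : ∑ i, ∑ j, w j * w i * ⟪y j, v i⟫_ℝ = ∑ i, ∑ j, w i * w j * ⟪y i, v j⟫_ℝ :=
    Finset.sum_comm
  have h5 : ∑ i, ∑ j, w i * (w j * ⟪y j, v j⟫_ℝ) = ∑ i, w i * ⟪y i, v i⟫_ℝ := by
    simp_rw [← Finset.mul_sum]
    rw [← Finset.sum_mul, hw1, one_mul]
  have h6 : ∑ i, ∑ j, w j * (w i * ⟪y i, v i⟫_ℝ) = ∑ i, w i * ⟪y i, v i⟫_ℝ := by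
    refine Finset.sum_congr rfl fun i _ => ?_
    rw [← Finset.sum_mul, hw1, one_mul]
  rw [h2] at h1
  simp only [Finset.sum_sub_distrib, Finset.sum_add_distrib] at h1
  rw [h3]
  linarith

/-- Finitely many monotonically related pairs can be extended by a pair `(p, -p)`. -/
lemma exists_monotone_extension_finite {ι : Type*} [Fintype ι] (y v : ι → E)
    (h : ∀ i j, 0 ≤ ⟪y i - y j, v i - v j⟫_ℝ) :
    ∃ p : E, ∀ i, ‖p‖ ^ 2 + ⟪p, v i - y i⟫_ℝ - ⟪y i, v i⟫_ℝ ≤ 0 := by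
  classical
  rcases isEmpty_or_nonempty ι with hι | hι
  · exact ⟨0, fun i => hι.elim i⟩
  -- At a vertex `w` of the simplex this payoff is `-⟪p - y i, -p - v i⟫`. A saddle point of
  -- nonpositive value therefore gives all the inequalities at once.
  let f : E → (ι → ℝ) → ℝ := fun p w =>
    ‖p‖ ^ 2 + ∑ i, w i * (⟪p, v i - y i⟫_ℝ - ⟪y i, v i⟫_ℝ)
  have hX : (convexHull ℝ (Set.range y)).Nonempty := (Set.range_nonempty y).convexHull
  have hkX : IsCompact (convexHull ℝ (Set.range y)) := (Set.finite_range y).isCompact_convexHull ℝ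
  have hcx : ∀ w, ConvexOn ℝ (convexHull ℝ (Set.range y)) fun p => f p w := by
    intro w
    have e : (fun p => f p w) = fun p =>
        ‖p‖ ^ 2 + (innerₛₗ ℝ (∑ i, w i • (v i - y i)) p - ∑ i, w i * ⟪y i, v i⟫_ℝ) := by
      funext p
      have h2 : innerₛₗ ℝ (∑ i, w i • (v i - y i)) p = ∑ i, w i * ⟪p, v i - y i⟫_ℝ := by
        rw [innerₛₗ_apply_apply, real_inner_comm, inner_sum]
        exact Finset.sum_congr rfl fun i _ => real_inner_smul_right _ _ _
      simp only [f, h2, mul_sub, Finset.sum_sub_distrib]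
    rw [e]
    have h1 : ConvexOn ℝ (convexHull ℝ (Set.range y)) fun p : E => ‖p‖ ^ 2 :=
      (convexOn_norm (E := E) (convex_convexHull ℝ _)).pow (fun _ _ => norm_nonneg _) 2
    exact h1.add ((LinearMap.convexOn _ (convex_convexHull ℝ _)).sub
      (concaveOn_const _ (convex_convexHull ℝ _)))
  have hcv : ∀ p, ConcaveOn ℝ (stdSimplex ℝ ι) (f p) := by
    intro p
    refine ⟨convex_stdSimplex ℝ ι, fun a _ b _ s t _ _ hst => le_of_eq ?_⟩
    simp only [f, smul_eq_mul, Pi.add_apply, Pi.smul_apply, add_mul, Finset.sum_add_distrib,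
      mul_assoc, ← Finset.mul_sum]
    linear_combination ‖p‖ ^ 2 * hst
  obtain ⟨p, hp, w, hw, hs⟩ := Sion.exists_isSaddlePointOn' (f := f) (ne_X := hX) (kX := hkX)
    (hfy := fun w _ =>
      (Continuous.lowerSemicontinuous (by fun_prop)).lowerSemicontinuousOn _)
    (hfy' := fun w _ => (hcx w).quasiconvexOn) (cY := convex_stdSimplex ℝ ι)
    (hfx := fun p _ =>
      (Continuous.upperSemicontinuous (by fun_prop)).upperSemicontinuousOn _)
    (hfx' := fun p _ => (hcv p).quasiconcaveOn) (cX := convex_convexHull ℝ _)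
    (ne_Y := ⟨_, single_mem_stdSimplex ℝ hι.some⟩) (kY := isCompact_stdSimplex ℝ ι)
  refine ⟨p, fun i => ?_⟩
  -- Testing the saddle point at the barycentre of the `y j` cancels `‖p‖ ^ 2` against the
  -- `y`-terms, leaving minus the covariance of `y` and `v`.
  have h1 := hs (∑ j, w j • y j)
    ((convex_convexHull ℝ _).sum_mem (fun j _ => hw.1 j) hw.2
      fun j _ => subset_convexHull ℝ _ ⟨j, rfl⟩) (Pi.single i 1) (single_mem_stdSimplex ℝ i)
  have h2 : f p (Pi.single i 1) = ‖p‖ ^ 2 + ⟪p, v i - y i⟫_ℝ - ⟪y i, v i⟫_ℝ := by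
    simp only [f, Pi.single_apply, ite_mul, one_mul, zero_mul, Finset.sum_ite_eq',
      Finset.mem_univ, if_true]
    ring
  have h3 : f (∑ j, w j • y j) w
      = ⟪∑ j, w j • y j, ∑ j, w j • v j⟫_ℝ - ∑ j, w j * ⟪y j, v j⟫_ℝ := by
    have h4 : ∀ (p : E) (z : ι → E), ⟪p, ∑ j, w j • z j⟫_ℝ = ∑ j, w j * ⟪p, z j⟫_ℝ := by
      intro p z
      rw [inner_sum]
      exact Finset.sum_congr rfl fun j _ => real_inner_smul_right _ _ _
    have h5 := h4 (∑ j, w j • y j) y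
    rw [real_inner_self_eq_norm_sq] at h5
    simp only [f, mul_sub, Finset.sum_sub_distrib, inner_sub_right, h4]
    linarith
  have h4 := inner_centerOfMass_le w hw.1 hw.2 y v h
  linarith

/-- Minty's theorem: `Id + T` is surjective when `T` is maximally monotone. -/
theorem IsMaximallyMonotone.exists_sub_mem [FiniteDimensional ℝ E] {T : E → Set E}
    (hT : IsMaximallyMonotone T) (z : E) : ∃ p, z - p ∈ T p := by
  -- `S q` consists of the `p` for which `(p, z - p)` is monotonically related to `q`. By maximality
  -- it suffices to find a common point; the finite lemma, with `v` shifted by `z`, gives the finite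
  -- intersection property.
  let S : {q : E × E // q.2 ∈ T q.1} → Set E := fun q =>
    {p | ‖p‖ ^ 2 + ⟪p, (q.1.2 - z) - q.1.1⟫_ℝ - ⟪q.1.1, q.1.2 - z⟫_ℝ ≤ 0}
  have hSc : ∀ q, IsClosed (S q) := fun q => isClosed_le (by fun_prop) continuous_const
  have key : ∀ p (q : {q : E × E // q.2 ∈ T q.1}), p ∈ S q →
      0 ≤ ⟪p - q.1.1, (z - p) - q.1.2⟫_ℝ := by
    intro p q hq
    have hq' : ‖p‖ ^ 2 + ⟪p, (q.1.2 - z) - q.1.1⟫_ℝ - ⟪q.1.1, q.1.2 - z⟫_ℝ ≤ 0 := hq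
    rw [← real_inner_self_eq_norm_sq] at hq'
    simp only [inner_sub_left, inner_sub_right] at hq' ⊢
    linarith [real_inner_comm p q.1.1]
  have hfin : ∀ u : Finset {q : E × E // q.2 ∈ T q.1}, ∃ p, ∀ q ∈ u, p ∈ S q := by
    intro u
    obtain ⟨p, hp⟩ := exists_monotone_extension_finite (fun q : u => q.1.1.1)
      (fun q : u => q.1.1.2 - z) (fun i j => by
        rw [sub_sub_sub_cancel_right]
        exact hT.1 _ _ _ i.1.2 _ j.1.2)
    exact ⟨p, fun q hq => hp ⟨q, hq⟩⟩
  have hall : ∃ p, ∀ q, p ∈ S q := by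
    by_cases hne : Nonempty {q : E × E // q.2 ∈ T q.1}
    · obtain ⟨q0⟩ := hne
      -- The quadratic term dominates outside this ball, so a single `S q0` is compact.
      have hbd : Bornology.IsBounded (S q0) := by
        refine (Metric.isBounded_closedBall (x := (0 : E))
          (r := 1 + ‖(q0.1.2 - z) - q0.1.1‖ + |⟪q0.1.1, q0.1.2 - z⟫_ℝ|)).subset ?_
        intro p hp
        rw [mem_closedBall_zero_iff]
        have hp' : ‖p‖ ^ 2 + ⟪p, (q0.1.2 - z) - q0.1.1⟫_ℝ - ⟪q0.1.1, q0.1.2 - z⟫_ℝ ≤ 0 := hp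
        have h1 := neg_le_of_abs_le (abs_real_inner_le_norm p ((q0.1.2 - z) - q0.1.1))
        have h2 := le_abs_self ⟪q0.1.1, q0.1.2 - z⟫_ℝ
        have h3 := abs_nonneg ⟪q0.1.1, q0.1.2 - z⟫_ℝ
        have h4 := norm_nonneg ((q0.1.2 - z) - q0.1.1)
        have h5 := norm_nonneg p
        by_contra hlt
        push Not at hlt
        nlinarith
      obtain ⟨p, -, hp⟩ := (Metric.isCompact_of_isClosed_isBounded (hSc q0)
        hbd).inter_iInter_nonempty S hSc (fun u => by
          classical
          obtain ⟨p, hp⟩ := hfin (insert q0 u)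
          refine ⟨p, hp _ (Finset.mem_insert_self _ _), ?_⟩
          simp only [Set.mem_iInter]
          exact fun q hq => hp q (Finset.mem_insert_of_mem hq))
      exact ⟨p, fun q => Set.mem_iInter.1 hp q⟩
    · exact ⟨0, fun q => (hne ⟨q⟩).elim⟩
  obtain ⟨p, hp⟩ := hall
  exact ⟨p, hT.2 _ _ fun y v hv => key p ⟨(y, v), hv⟩ (hp ⟨(y, v), hv⟩)⟩

lemma IsMaximallyMonotone.smul {T : E → Set E} (hT : IsMaximallyMonotone T) {c : ℝ} (hc : 0 < c) :
    IsMaximallyMonotone fun p => c • T p := by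
  constructor
  · rintro x y _ ⟨u, hu, rfl⟩ _ ⟨v, hv, rfl⟩
    change 0 ≤ ⟪x - y, c • u - c • v⟫_ℝ
    rw [← smul_sub, real_inner_smul_right]
    exact mul_nonneg hc.le (hT.1 x y u hu v hv)
  · intro x u h
    refine ⟨c⁻¹ • u, hT.2 _ _ fun y v hv => ?_, smul_inv_smul₀ hc.ne' u⟩
    have h1 := h y (c • v) ⟨v, hv, rfl⟩
    have h2 : u - c • v = c • (c⁻¹ • u - v) := by rw [smul_sub, smul_inv_smul₀ hc.ne']
    rw [h2, real_inner_smul_right] at h1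
    exact nonneg_of_mul_nonneg_right h1 hc

/-- The resolvent of `c T` at `y` is the point `p` with `c⁻¹ (y - p) ∈ T p`. -/
lemma IsMaximallyMonotone.resolvent_smul_spec [FiniteDimensional ℝ E] {T : E → Set E}
    (hT : IsMaximallyMonotone T) {c : ℝ} (hc : 0 < c) (y : E) :
    c⁻¹ • (y - resolvent (fun p => c • T p) y) ∈ T (resolvent (fun p => c • T p) y) := by
  obtain ⟨p, hp⟩ := (hT.smul hc).exists_sub_mem y
  have hex : ∃ p : E, y ∈ ({p} : Set E) + c • T p :=
    ⟨p, Set.mem_add.2 ⟨p, rfl, y - p, hp, add_sub_cancel _ _⟩⟩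
  have h := Classical.epsilon_spec hex
  obtain ⟨q, hq, w, ⟨w', hw', hw⟩, hy⟩ := Set.mem_add.1 h
  have hq' : q = resolvent (fun p => c • T p) y := hq
  have hw2 : c • w' = w := hw
  subst hq'
  have : c⁻¹ • (y - resolvent (fun p => c • T p) y) = w' := by
    rw [sub_eq_of_eq_add' hy.symm, ← hw2, inv_smul_smul₀ hc.ne']
  rw [this]
  exact hw'

/-- The graph of a maximally monotone operator is sequentially closed. -/
lemma IsMaximallyMonotone.mem_of_tendsto {T : E → Set E} (hT : IsMaximallyMonotone T)
    {x u : ℕ → E} {x' u' : E} (hx : Tendsto x atTop (𝓝 x')) (hu : Tendsto u atTop (𝓝 u'))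
    (h : ∀ n, u n ∈ T (x n)) : u' ∈ T x' :=
  hT.2 _ _ fun y v hv => ge_of_tendsto' ((hx.sub_const y).inner (hu.sub_const v))
    fun n => hT.1 _ _ _ (h n) _ hv

lemma normalCone_monotone (C : Set E) : IsMonotoneOp (normalCone C) := by
  intro x y u hu v hv
  have h1 := hu.2 y hv.1
  have h2 := hv.2 x hu.1
  simp only [inner_sub_left, inner_sub_right] at h1 h2 ⊢
  linarith

/-- The graph of the normal cone of a closed set is sequentially closed. -/
lemma mem_normalCone_of_tendsto {C : Set E} (hC : IsClosed C)
    {x u : ℕ → E} {x' u' : E} (hx : Tendsto x atTop (𝓝 x')) (hu : Tendsto u atTop (𝓝 u'))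
    (h : ∀ n, u n ∈ normalCone C (x n)) : u' ∈ normalCone C x' :=
  ⟨hC.mem_of_tendsto hx (Eventually.of_forall fun n => (h n).1), fun z hz =>
    le_of_tendsto' ((hx.const_sub z).inner hu) fun n => (h n).2 z hz⟩

lemma smul_mem_normalCone {C : Set E} {x u : E} (h : u ∈ normalCone C x) {c : ℝ} (hc : 0 ≤ c) :
    c • u ∈ normalCone C x :=
  ⟨h.1, fun z hz => by
    rw [real_inner_smul_right]
    exact mul_nonpos_of_nonneg_of_nonpos hc (h.2 z hz)⟩

lemma sub_projSet_mem_normalCone [FiniteDimensional ℝ E] {C : Set E} (hne : C.Nonempty)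
    (hcl : IsClosed C) (hcv : Convex ℝ C) (y : E) :
    y - projSet C y ∈ normalCone C (projSet C y) := by
  have hex : ∃ p : E, p ∈ C ∧ ∀ z ∈ C, ‖y - p‖ ≤ ‖y - z‖ := by
    obtain ⟨p, hp, h⟩ := hcl.exists_infDist_eq_dist hne y
    refine ⟨p, hp, fun z hz => ?_⟩
    rw [← dist_eq_norm, ← dist_eq_norm, ← h]
    exact Metric.infDist_le_dist_of_mem hz
  obtain ⟨hm, h⟩ : projSet C y ∈ C ∧ ∀ z ∈ C, ‖y - projSet C y‖ ≤ ‖y - z‖ :=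
    Classical.epsilon_spec hex
  refine ⟨hm, fun z hz => ?_⟩
  have : Nonempty C := hne.to_subtype
  rw [real_inner_comm]
  refine (norm_eq_iInf_iff_real_inner_le_zero hcv hm).1 (le_antisymm ?_ ?_) z hz
  · exact le_ciInf fun w => h w w.2
  · exact ciInf_le (f := fun w : C => ‖y - w‖)
      ⟨0, by rintro _ ⟨w, rfl⟩; exact norm_nonneg _⟩ ⟨_, hm⟩

/-- Two points of the graph of a monotone operator are at most as far apart as their sums. -/
lemma IsMonotoneOp.norm_sub_le_norm_add_sub {T : E → Set E} (hT : IsMonotoneOp T) {x y u v : E}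
    (hu : u ∈ T x) (hv : v ∈ T y) {c : ℝ} (hc : 0 ≤ c) :
    ‖x - y‖ ≤ ‖(x + c • u) - (y + c • v)‖ := by
  have h1 := mul_nonneg hc (hT x y u hu v hv)
  have h2 : (x + c • u) - (y + c • v) = (x - y) + c • (u - v) := by
    rw [smul_sub]; abel
  rw [h2]
  refine le_of_sq_le_sq ?_ (norm_nonneg _)
  rw [norm_add_sq_real, real_inner_smul_right]
  nlinarith [sq_nonneg ‖c • (u - v)‖]

/-- Every normal vector is thus of the form `y - proj y`, which is how normals are later seen to lie
in `U`. -/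
lemma projSet_eq_of_mem_normalCone [FiniteDimensional ℝ E] {C : Set E} (hne : C.Nonempty)
    (hcl : IsClosed C) (hcv : Convex ℝ C) {x u : E} (h : u ∈ normalCone C x) :
    projSet C (x + u) = x := by
  have h1 := (normalCone_monotone C).norm_sub_le_norm_add_sub
    (sub_projSet_mem_normalCone hne hcl hcv (x + u)) h zero_le_one
  simpa [sub_eq_zero] using h1

end OperatorTheory

/-! ### Bounded activation delays. -/

section Delay

lemma exists_last_activation {S : Set ℕ} (h0 : 0 ∈ S) {m : ℕ}
    (hS : ∀ n, ∃ j ∈ Set.Icc n (n + m), j ∈ S) :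
    ∃ ν : ℕ → ℕ, ∀ n, ν n ≤ n ∧ n ≤ ν n + m ∧ ν n ∈ S ∧ ∀ i, ν n < i → i ≤ n → i ∉ S := by
  classical
  refine ⟨fun n => Nat.findGreatest (· ∈ S) n, fun n =>
    ⟨Nat.findGreatest_le n, ?_, Nat.findGreatest_spec (P := (· ∈ S)) (Nat.zero_le n) h0,
      fun i h1 h2 => Nat.findGreatest_is_greatest h1 h2⟩⟩
  -- For `n ≤ m` any activation time is recent enough, and time `0` supplies one. Otherwise the
  -- window `[n - m, n]` contains one.
  rcases le_total n m with hn | hn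
  · exact hn.trans (Nat.le_add_left _ _)
  · obtain ⟨j, ⟨h1, h2⟩, hj⟩ := hS (n - m)
    have h3 : j ≤ Nat.findGreatest (· ∈ S) n := Nat.le_findGreatest (by omega) hj
    change n ≤ Nat.findGreatest (· ∈ S) n + m
    omega

lemma eq_of_frozen {α : Type*} {S : Set ℕ} {f : ℕ → α} (hf : ∀ n, n + 1 ∉ S → f (n + 1) = f n)
    {k n : ℕ} (hkn : k ≤ n) (h : ∀ i, k < i → i ≤ n → i ∉ S) : f n = f k := by
  induction n, hkn using Nat.le_induction with
  | base => rfl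
  | succ n hn ih =>
    rw [hf n (h _ (Nat.lt_succ_of_le hn) le_rfl), ih fun i h1 h2 => h i h1 (h2.trans n.le_succ)]

variable {E : Type*} [NormedAddCommGroup E]

/-- The difference telescopes into at most `m` increments, each of which vanishes. -/
lemma tendsto_delay_sub {x : ℕ → E} (hx : Tendsto (fun n => x (n + 1) - x n) atTop (𝓝 0))
    {ν : ℕ → ℕ} {m : ℕ} (h1 : ∀ n, ν n ≤ n) (h2 : ∀ n, n ≤ ν n + m) :
    Tendsto (fun n => x (ν n) - x n) atTop (𝓝 0) := by
  rw [Metric.tendsto_atTop] at hx ⊢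
  intro r hr
  obtain ⟨N, hN⟩ := hx (r / (m + 1)) (by positivity)
  refine ⟨N + m, fun n hn => ?_⟩
  have h3 : dist (x (ν n)) (x n) ≤ ∑ i ∈ Finset.Ico (ν n) n, r / (m + 1) := by
    refine dist_le_Ico_sum_of_dist_le (h1 n) fun {k} hk _ => ?_
    have h4 := h2 n
    have h5 := hN k (by omega)
    rw [dist_zero_right] at h5
    rw [dist_comm, dist_eq_norm]
    exact h5.le
  rw [dist_zero_right, ← dist_eq_norm]
  refine h3.trans_lt ?_
  rw [Finset.sum_const, Nat.card_Ico, nsmul_eq_mul, mul_div_assoc', div_lt_iff₀ (by positivity),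
    mul_comm]
  have h6 : ((n - ν n : ℕ) : ℝ) ≤ m := by
    have := h2 n
    exact_mod_cast (by omega : n - ν n ≤ m)
  nlinarith

end Delay

/-! ### Resolvent steps with perturbed data. -/

section ResolventAsymptotics

variable {E : Type*} [NormedAddCommGroup E] [InnerProductSpace ℝ E]

/-- Resolvent steps taken from bounded data with bounded step sizes are bounded. -/
lemma IsMonotoneOp.exists_bound {T : E → Set E} (hT : IsMonotoneOp T) {y w : E} (hw : w ∈ T y)
    {ε B : ℝ} (hε : 0 < ε) {c : ℕ → ℝ} (hc : ∀ n, c n ∈ Set.Icc ε (1 / ε)) {p l a α : ℕ → E}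
    (hp : ∀ n, ‖p n‖ ≤ B) (hl : ∀ n, ‖l n‖ ≤ B) (hα : ∀ n, α n ∈ T (a n))
    (h : ∀ n, α n = (c n)⁻¹ • (p n - a n) - l n) :
    ∃ K, ∀ n, ‖a n‖ ≤ K ∧ ‖α n‖ ≤ K := by
  have hB : 0 ≤ B := (norm_nonneg _).trans (hp 0)
  let K₁ : ℝ := B + 1 / ε * B + (‖y‖ + 1 / ε * ‖w‖) + ‖y‖
  let K₂ : ℝ := 1 / ε * (B + K₁) + B
  have ha : ∀ n, ‖a n‖ ≤ K₁ := by
    intro n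
    have hcn : 0 < c n := hε.trans_le (hc n).1
    have h1 := hT.norm_sub_le_norm_add_sub (hα n) hw hcn.le
    -- The resolvent is nonexpansive, so comparison with the fixed graph point `(y, w)` bounds `a n`
    -- by the input.
    have h2 : a n + c n • α n = p n - c n • l n := by
      rw [h n, smul_sub, smul_inv_smul₀ hcn.ne']
      abel
    rw [h2] at h1
    have h3 : ‖p n - c n • l n - (y + c n • w)‖
        ≤ (‖p n‖ + c n * ‖l n‖) + (‖y‖ + c n * ‖w‖) := by
      refine (norm_sub_le _ _).trans (add_le_add ((norm_sub_le _ _).trans ?_)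
        ((norm_add_le _ _).trans ?_)) <;>
      rw [norm_smul, Real.norm_of_nonneg hcn.le]
    have h4 : c n * ‖l n‖ ≤ 1 / ε * B :=
      mul_le_mul (hc n).2 (hl n) (norm_nonneg _) (by positivity)
    have h5 : c n * ‖w‖ ≤ 1 / ε * ‖w‖ := mul_le_mul_of_nonneg_right (hc n).2 (norm_nonneg _)
    have h6 : ‖a n‖ ≤ ‖a n - y‖ + ‖y‖ := by simpa using norm_add_le (a n - y) y
    have h7 := hp n
    simp only [K₁]
    linarith
  have hK₁ : 0 ≤ K₁ := (norm_nonneg _).trans (ha 0)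
  refine ⟨max K₁ K₂, fun n => ⟨(ha n).trans (le_max_left _ _), le_trans ?_ (le_max_right _ _)⟩⟩
  have hcn : 0 < c n := hε.trans_le (hc n).1
  have h1 : (c n)⁻¹ ≤ 1 / ε := by
    rw [one_div]
    exact inv_anti₀ hε (hc n).1
  rw [h n]
  refine (norm_sub_le _ _).trans (add_le_add ?_ (hl n))
  rw [norm_smul, Real.norm_of_nonneg (inv_pos.2 hcn).le]
  exact mul_le_mul h1 ((norm_sub_le _ _).trans (add_le_add (hp n) (ha n))) (norm_nonneg _)
    (by positivity)

variable {ε : ℝ} {c : ℕ → ℝ} {x l p q a α : ℕ → E}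

/-- Without delay (`p = x`, `q = l`) the two terms coincide. The error is linear in `p - x` and `q -
l`, with bounded coefficients. -/
lemma tendsto_inner_sub_residual (hε : 0 < ε) (hc : ∀ n, c n ∈ Set.Icc ε (1 / ε))
    {B : ℝ} (hx : ∀ n, ‖x n‖ ≤ B) (hp : ∀ n, ‖p n‖ ≤ B) (ha : ∀ n, ‖a n‖ ≤ B)
    (h : ∀ n, α n = (c n)⁻¹ • (p n - a n) - q n)
    (hpx : Tendsto (fun n => p n - x n) atTop (𝓝 0))
    (hql : Tendsto (fun n => q n - l n) atTop (𝓝 0)) :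
    Tendsto (fun n => ⟪x n - a n, α n + l n⟫_ℝ - (c n)⁻¹ * ‖p n - a n‖ ^ 2) atTop (𝓝 0) := by
  have hbound : ∀ n, ‖⟪x n - a n, α n + l n⟫_ℝ - (c n)⁻¹ * ‖p n - a n‖ ^ 2‖
      ≤ ‖p n - x n‖ * (1 / ε * (B + B)) + (B + B) * ‖q n - l n‖ := by
    intro n
    have hcn : 0 < c n := hε.trans_le (hc n).1
    have h1 : (c n)⁻¹ ≤ 1 / ε := by
      rw [one_div]
      exact inv_anti₀ hε (hc n).1
    have e : ⟪x n - a n, α n + l n⟫_ℝ - (c n)⁻¹ * ‖p n - a n‖ ^ 2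
        = -⟪p n - x n, (c n)⁻¹ • (p n - a n)⟫_ℝ - ⟪x n - a n, q n - l n⟫_ℝ := by
      have e1 : x n - a n = (p n - a n) - (p n - x n) := by abel
      have e2 : α n + l n = (c n)⁻¹ • (p n - a n) - (q n - l n) := by rw [h n]; abel
      rw [e2, inner_sub_right, e1, inner_sub_left, real_inner_smul_right, real_inner_smul_right,
        real_inner_self_eq_norm_sq]
      ring
    rw [e]
    refine (norm_sub_le _ _).trans (add_le_add ?_ ?_)
    · rw [norm_neg]
      refine (norm_inner_le_norm _ _).trans (mul_le_mul_of_nonneg_left ?_ (norm_nonneg _))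
      rw [norm_smul, Real.norm_of_nonneg (inv_pos.2 hcn).le]
      exact mul_le_mul h1 ((norm_sub_le _ _).trans (add_le_add (hp n) (ha n))) (norm_nonneg _)
        (by positivity)
    · exact (norm_inner_le_norm _ _).trans (mul_le_mul_of_nonneg_right
        ((norm_sub_le _ _).trans (add_le_add (hx n) (ha n))) (norm_nonneg _))
  refine squeeze_zero_norm hbound ?_
  simpa using (hpx.norm.mul_const (1 / ε * (B + B))).add (hql.norm.const_mul (B + B))

/-- The upper bound on `c` extracts `p - a → 0` from the residual; the lower bound keeps `c⁻¹ (p -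
a)` small as well. -/
lemma tendsto_of_residual (hε : 0 < ε) (hc : ∀ n, c n ∈ Set.Icc ε (1 / ε))
    (h : ∀ n, α n = (c n)⁻¹ • (p n - a n) - q n)
    (hpx : Tendsto (fun n => p n - x n) atTop (𝓝 0))
    (hql : Tendsto (fun n => q n - l n) atTop (𝓝 0))
    (hr : Tendsto (fun n => (c n)⁻¹ * ‖p n - a n‖ ^ 2) atTop (𝓝 0)) :
    Tendsto (fun n => a n - x n) atTop (𝓝 0) ∧ Tendsto (fun n => α n + l n) atTop (𝓝 0) := by
  have hcn : ∀ n, 0 < c n := fun n => hε.trans_le (hc n).1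
  have hsq : Tendsto (fun n => ‖p n - a n‖ ^ 2) atTop (𝓝 0) := by
    refine squeeze_zero (fun n => sq_nonneg _) (fun n => ?_) (by simpa using hr.const_mul (1 / ε))
    calc ‖p n - a n‖ ^ 2 = c n * ((c n)⁻¹ * ‖p n - a n‖ ^ 2) := by
          rw [mul_inv_cancel_left₀ (hcn n).ne']
      _ ≤ ε⁻¹ * ((c n)⁻¹ * ‖p n - a n‖ ^ 2) :=
          mul_le_mul_of_nonneg_right (one_div ε ▸ (hc n).2)
            (mul_nonneg (inv_pos.2 (hcn n)).le (sq_nonneg _))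
  have hpa : Tendsto (fun n => p n - a n) atTop (𝓝 0) := by
    rw [tendsto_zero_iff_norm_tendsto_zero]
    simpa using hsq.sqrt
  constructor
  · simpa using hpx.sub hpa
  · have h1 : Tendsto (fun n => (c n)⁻¹ • (p n - a n)) atTop (𝓝 0) := by
      refine squeeze_zero_norm (fun n => ?_) (by simpa using hpa.norm.const_mul (1 / ε))
      rw [norm_smul, Real.norm_of_nonneg (inv_pos.2 (hcn n)).le]
      exact mul_le_mul_of_nonneg_right (inv_anti₀ hε (hc n).1) (norm_nonneg _)
    have h2 := h1.sub hql
    rw [sub_zero] at h2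
    refine h2.congr fun n => ?_
    rw [h n]
    abel

end ResolventAsymptotics

/-! ### Fejér monotone relaxed projections. -/

section Fejer

lemma exists_norm_le_of_antitone {H : Type*} [NormedAddCommGroup H] {p : ℕ → H} {z : H} (h : Antitone fun n => ‖p n - z‖ ^ 2) :
    ∃ B, ∀ n, ‖p n‖ ≤ B := by
  refine ⟨‖p 0 - z‖ + ‖z‖, fun n => ?_⟩
  have h1 : ‖p n - z‖ ≤ ‖p 0 - z‖ := le_of_sq_le_sq (h (Nat.zero_le n)) (norm_nonneg _)
  have h2 : ‖p n‖ ≤ ‖p n - z‖ + ‖z‖ := by simpa using norm_add_le (p n - z) z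
  linarith

variable {H : Type*} [NormedAddCommGroup H] [InnerProductSpace ℝ H]
  {ε : ℝ} {p w : ℕ → H} {κ θ : ℕ → ℝ}

/-- The relaxed projection step onto a half-space that contains `z` is Fejér monotone at `z`. -/
lemma norm_sq_relaxed_step_le (hε : 0 < ε) {p w z : H} {κ θ : ℝ}
    (hθ : w ≠ 0 → ∃ r ∈ Set.Icc ε (2 - ε), θ = r * max κ 0 / ‖w‖ ^ 2)
    (hz : κ ≤ ⟪p - z, w⟫_ℝ) :
    ‖p - θ • w - z‖ ^ 2 + ε ^ 2 * (max κ 0 ^ 2 / ‖w‖ ^ 2) ≤ ‖p - z‖ ^ 2 := by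
  rcases eq_or_ne w 0 with rfl | hw
  · simp
  obtain ⟨r, ⟨h1, h2⟩, rfl⟩ := hθ hw
  have hτ : 0 < ‖w‖ ^ 2 := by positivity
  have e : p - (r * max κ 0 / ‖w‖ ^ 2) • w - z = (p - z) - (r * max κ 0 / ‖w‖ ^ 2) • w := by abel
  rw [e, norm_sub_sq_real, real_inner_smul_right, norm_smul, mul_pow, Real.norm_eq_abs, sq_abs]
  have h3 : max κ 0 ^ 2 ≤ max κ 0 * ⟪p - z, w⟫_ℝ := by
    rcases le_total κ 0 with hk | hk
    · simp [max_eq_right hk]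
    · rw [max_eq_left hk, sq]
      exact mul_le_mul_of_nonneg_left hz hk
  have h4 : (r * max κ 0 / ‖w‖ ^ 2) ^ 2 * ‖w‖ ^ 2 = r ^ 2 * (max κ 0 ^ 2 / ‖w‖ ^ 2) := by
    field_simp
  have h5 : r * (max κ 0 ^ 2 / ‖w‖ ^ 2) ≤ r * max κ 0 / ‖w‖ ^ 2 * ⟪p - z, w⟫_ℝ := by
    have : r * max κ 0 / ‖w‖ ^ 2 * ⟪p - z, w⟫_ℝ
        = r * ((max κ 0 * ⟪p - z, w⟫_ℝ) / ‖w‖ ^ 2) := by ring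
    rw [this]
    exact mul_le_mul_of_nonneg_left (div_le_div_of_nonneg_right h3 hτ.le) (hε.le.trans h1)
  have h6 : 0 ≤ max κ 0 ^ 2 / ‖w‖ ^ 2 := by positivity
  -- Both factors are at least `ε`; this is where relaxation away from `0` and `2` yields a definite
  -- decrease.
  have h7 : ε ^ 2 ≤ r * (2 - r) := by nlinarith
  rw [h4]
  nlinarith [mul_le_mul_of_nonneg_right h7 h6]

lemma norm_sq_relaxed_step_sub_le (hε : 0 < ε) {w : H} {κ θ : ℝ}
    (hθ : w ≠ 0 → ∃ r ∈ Set.Icc ε (2 - ε), θ = r * max κ 0 / ‖w‖ ^ 2) :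
    ‖θ • w‖ ^ 2 ≤ 4 * (max κ 0 ^ 2 / ‖w‖ ^ 2) := by
  rcases eq_or_ne w 0 with rfl | hw
  · simp
  obtain ⟨r, ⟨h1, h2⟩, rfl⟩ := hθ hw
  have hτ : 0 < ‖w‖ ^ 2 := by positivity
  rw [norm_smul, mul_pow, Real.norm_eq_abs, sq_abs]
  have h4 : (r * max κ 0 / ‖w‖ ^ 2) ^ 2 * ‖w‖ ^ 2 = r ^ 2 * (max κ 0 ^ 2 / ‖w‖ ^ 2) := by
    field_simp
  rw [h4]
  have h6 : 0 ≤ max κ 0 ^ 2 / ‖w‖ ^ 2 := by positivity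
  have h7 : r ^ 2 ≤ 4 := by nlinarith
  exact mul_le_mul_of_nonneg_right h7 h6

lemma fejer_step_le (hε : 0 < ε)
    (hθ : ∀ n, w n ≠ 0 → ∃ r ∈ Set.Icc ε (2 - ε), θ n = r * max (κ n) 0 / ‖w n‖ ^ 2)
    (hp : ∀ n, p (n + 1) = p n - θ n • w n) {z : H} (hz : ∀ n, κ n ≤ ⟪p n - z, w n⟫_ℝ) (n : ℕ) :
    ‖p (n + 1) - z‖ ^ 2 + ε ^ 2 * (max (κ n) 0 ^ 2 / ‖w n‖ ^ 2) ≤ ‖p n - z‖ ^ 2 := by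
  rw [hp n]
  exact norm_sq_relaxed_step_le hε (hθ n) (hz n)

lemma fejer_antitone (hε : 0 < ε)
    (hθ : ∀ n, w n ≠ 0 → ∃ r ∈ Set.Icc ε (2 - ε), θ n = r * max (κ n) 0 / ‖w n‖ ^ 2)
    (hp : ∀ n, p (n + 1) = p n - θ n • w n) {z : H} (hz : ∀ n, κ n ≤ ⟪p n - z, w n⟫_ℝ) :
    Antitone fun n => ‖p n - z‖ ^ 2 :=
  antitone_nat_of_succ_le fun n => by
    have h1 := fejer_step_le hε hθ hp hz n
    have h2 : 0 ≤ ε ^ 2 * (max (κ n) 0 ^ 2 / ‖w n‖ ^ 2) := by positivity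
    linarith

/-- The squared distances to `z` decrease and are bounded below, so their successive differences,
which dominate the gap, tend to zero. -/
lemma tendsto_fejer_gap (hε : 0 < ε)
    (hθ : ∀ n, w n ≠ 0 → ∃ r ∈ Set.Icc ε (2 - ε), θ n = r * max (κ n) 0 / ‖w n‖ ^ 2)
    (hp : ∀ n, p (n + 1) = p n - θ n • w n) {z : H} (hz : ∀ n, κ n ≤ ⟪p n - z, w n⟫_ℝ) :
    Tendsto (fun n => max (κ n) 0 ^ 2 / ‖w n‖ ^ 2) atTop (𝓝 0) := by
  have h1 := tendsto_atTop_ciInf (fejer_antitone hε hθ hp hz)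
    ⟨0, by rintro _ ⟨n, rfl⟩; exact sq_nonneg _⟩
  have h2 := (h1.sub (h1.comp (tendsto_add_atTop_nat 1))).const_mul (1 / ε ^ 2)
  rw [sub_self, mul_zero] at h2
  refine squeeze_zero (fun n => by positivity) (fun n => ?_) h2
  have h3 := fejer_step_le hε hθ hp hz n
  have h4 : max (κ n) 0 ^ 2 / ‖w n‖ ^ 2
      = 1 / ε ^ 2 * (ε ^ 2 * (max (κ n) 0 ^ 2 / ‖w n‖ ^ 2)) := by
    field_simp
  rw [h4]
  refine mul_le_mul_of_nonneg_left ?_ (by positivity)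
  simp only [Function.comp_apply]
  linarith

lemma tendsto_fejer_step (hε : 0 < ε)
    (hθ : ∀ n, w n ≠ 0 → ∃ r ∈ Set.Icc ε (2 - ε), θ n = r * max (κ n) 0 / ‖w n‖ ^ 2)
    (hp : ∀ n, p (n + 1) = p n - θ n • w n) {z : H} (hz : ∀ n, κ n ≤ ⟪p n - z, w n⟫_ℝ) :
    Tendsto (fun n => p (n + 1) - p n) atTop (𝓝 0) := by
  have h1 : Tendsto (fun n => ‖p (n + 1) - p n‖ ^ 2) atTop (𝓝 0) := by
    refine squeeze_zero (fun n => sq_nonneg _) (fun n => ?_)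
      (by simpa using (tendsto_fejer_gap hε hθ hp hz).const_mul 4)
    rw [hp n, sub_sub_cancel_left, norm_neg]
    exact norm_sq_relaxed_step_sub_le hε (hθ n)
  rw [tendsto_zero_iff_norm_tendsto_zero]
  simpa using h1.sqrt

lemma tendsto_fejer_max (hε : 0 < ε)
    (hθ : ∀ n, w n ≠ 0 → ∃ r ∈ Set.Icc ε (2 - ε), θ n = r * max (κ n) 0 / ‖w n‖ ^ 2)
    (hp : ∀ n, p (n + 1) = p n - θ n • w n) {z : H} (hz : ∀ n, κ n ≤ ⟪p n - z, w n⟫_ℝ)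
    {K : ℝ} (hw : ∀ n, ‖w n‖ ^ 2 ≤ K) :
    Tendsto (fun n => max (κ n) 0) atTop (𝓝 0) := by
  have h1 : Tendsto (fun n => max (κ n) 0 ^ 2) atTop (𝓝 0) := by
    refine squeeze_zero (fun n => sq_nonneg _) (fun n => ?_)
      (by simpa using (tendsto_fejer_gap hε hθ hp hz).const_mul K)
    -- When `w n = 0` the quotient carries no information, but the half-space inequality itself
    -- forces `κ n ≤ 0`.
    rcases eq_or_ne (w n) 0 with h0 | h0
    · have h2 := hz n
      rw [h0, inner_zero_right] at h2
      simp [h0, max_eq_right h2]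
    · have hτ : 0 < ‖w n‖ ^ 2 := by positivity
      calc max (κ n) 0 ^ 2 = ‖w n‖ ^ 2 * (max (κ n) 0 ^ 2 / ‖w n‖ ^ 2) := by field_simp
        _ ≤ K * (max (κ n) 0 ^ 2 / ‖w n‖ ^ 2) :=
          mul_le_mul_of_nonneg_right (hw n) (by positivity)
  simpa [Real.sqrt_sq (le_max_right _ _)] using h1.sqrt

/-- A Fejér monotone sequence in a finite-dimensional space whose cluster points all belong to the
target set converges to a point of this set. -/
lemma exists_tendsto_of_fejer [FiniteDimensional ℝ H] {Z : Set H} (hne : Z.Nonempty)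
    (h : ∀ z ∈ Z, Antitone fun n => ‖p n - z‖ ^ 2)
    (hcl : ∀ φ : ℕ → ℕ, StrictMono φ → ∀ z, Tendsto (p ∘ φ) atTop (𝓝 z) → z ∈ Z) :
    ∃ z ∈ Z, Tendsto p atTop (𝓝 z) := by
  obtain ⟨z₀, hz₀⟩ := hne
  obtain ⟨B, hB⟩ := exists_norm_le_of_antitone (h z₀ hz₀)
  have := FiniteDimensional.proper_real H
  obtain ⟨z, -, φ, hφ, hlim⟩ := tendsto_subseq_of_bounded
    (Metric.isBounded_closedBall (x := (0 : H)) (r := B))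
    (fun n => mem_closedBall_zero_iff.2 (hB n))
  have hz := hcl φ hφ z hlim
  refine ⟨z, hz, ?_⟩
  have h1 := tendsto_atTop_ciInf (h z hz) ⟨0, by rintro _ ⟨n, rfl⟩; exact sq_nonneg _⟩
  have h2 : Tendsto (fun n => ‖p (φ n) - z‖ ^ 2) atTop (𝓝 0) := by
    simpa using ((hlim.sub_const z).norm.pow 2)
  -- The distances to the cluster point `z ∈ Z` converge, and along `φ` their limit is zero.
  rw [tendsto_nhds_unique (h1.comp hφ.tendsto_atTop) h2] at h1
  rw [tendsto_iff_norm_sub_tendsto_zero]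
  simpa using h1.sqrt

end Fejer

namespace DecisionModel

universe u

variable {M : DecisionModel.{u}}

/-! ### Policies and triples of policies. -/

section PolicySpace

lemma inner_policy (x y : M.Policy) :
    ⟪x, y⟫_ℝ = ∑ ξ : M.Scenario, M.prob ξ * ⟪x ξ, y ξ⟫_ℝ := rfl

lemma norm_policy_le {x : M.Policy} {B : ℝ} (hB : 0 ≤ B) (h : ∀ ξ, ‖x ξ‖ ≤ B) : ‖x‖ ≤ B := by
  refine le_of_sq_le_sq ?_ hB
  rw [← real_inner_self_eq_norm_sq, inner_policy]
  calc ∑ ξ : M.Scenario, M.prob ξ * ⟪x ξ, x ξ⟫_ℝ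
      ≤ ∑ ξ : M.Scenario, M.prob ξ * B ^ 2 := by
        refine Finset.sum_le_sum fun ξ _ => mul_le_mul_of_nonneg_left ?_ (M.prob_pos ξ).le
        rw [real_inner_self_eq_norm_sq]
        exact pow_le_pow_left₀ (norm_nonneg _) (h ξ) 2
    _ = B ^ 2 := by rw [← Finset.sum_mul, M.prob_sum, one_mul]

/-- The decision taken in a given scenario, as a continuous linear map. -/
def evalCLM (ξ : M.Scenario) : M.Policy →L[ℝ] M.Decision :=
  LinearMap.toContinuousLinearMap
    { toFun := fun x => x ξ
      map_add' := fun _ _ => rfl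
      map_smul' := fun _ _ => rfl }

lemma tendsto_eval {x : ℕ → M.Policy} {y : M.Policy} (h : Tendsto x atTop (𝓝 y))
    (ξ : M.Scenario) : Tendsto (fun n => x n ξ) atTop (𝓝 (y ξ)) :=
  ((evalCLM ξ).continuous.tendsto y).comp h

lemma exists_eval_bound {x : ℕ → M.Policy} {B : ℝ} (h : ∀ n, ‖x n‖ ≤ B) (ξ : M.Scenario) :
    ∃ K, ∀ n, ‖x n ξ‖ ≤ K :=
  ⟨‖(evalCLM ξ : M.Policy →L[ℝ] M.Decision)‖ * B, fun n =>
    ((evalCLM ξ).le_opNorm (x n)).trans (mul_le_mul_of_nonneg_left (h n) (norm_nonneg _))⟩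

lemma exists_policy_bound {x : ℕ → M.Policy} (h : ∀ ξ, ∃ K, ∀ n, ‖x n ξ‖ ≤ K) :
    ∃ B, 0 ≤ B ∧ ∀ n, ‖x n‖ ≤ B := by
  choose K hK using h
  have h0 : ∀ ξ, 0 ≤ K ξ := fun ξ => (norm_nonneg _).trans (hK ξ 0)
  refine ⟨∑ ξ, K ξ, Finset.sum_nonneg fun ξ _ => h0 ξ, fun n =>
    norm_policy_le (Finset.sum_nonneg fun ξ _ => h0 ξ) fun ξ => (hK ξ n).trans ?_⟩
  exact Finset.single_le_sum (fun ξ _ => h0 ξ) (Finset.mem_univ ξ)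

/-- The Hilbert space of primal-dual triples of policies. -/
abbrev Triple (M : DecisionModel.{u}) : Type u := PiLp 2 fun _ : Fin 3 => M.Policy

/-- The triple with given components. -/
def triple (x y z : M.Policy) : M.Triple := WithLp.toLp 2 ![x, y, z]

@[simp] lemma triple_zero (x y z : M.Policy) : triple x y z 0 = x := rfl
@[simp] lemma triple_one (x y z : M.Policy) : triple x y z 1 = y := rfl
@[simp] lemma triple_two (x y z : M.Policy) : triple x y z 2 = z := rfl

lemma inner_triple (p q : M.Triple) :
    ⟪p, q⟫_ℝ = ⟪p 0, q 0⟫_ℝ + ⟪p 1, q 1⟫_ℝ + ⟪p 2, q 2⟫_ℝ := by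
  rw [PiLp.inner_apply, Fin.sum_univ_three]

lemma norm_sq_triple (p : M.Triple) : ‖p‖ ^ 2 = ‖p 0‖ ^ 2 + ‖p 1‖ ^ 2 + ‖p 2‖ ^ 2 := by
  rw [PiLp.norm_sq_eq_of_L2, Fin.sum_univ_three]

lemma tendsto_triple_apply {p : ℕ → M.Triple} {q : M.Triple} (h : Tendsto p atTop (𝓝 q))
    (i : Fin 3) : Tendsto (fun n => p n i) atTop (𝓝 (q i)) :=
  ((PiLp.continuous_apply 2 (fun _ : Fin 3 => M.Policy) i).tendsto q).comp h

end PolicySpace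

/-! ### The Kuhn–Tucker set and the delayed form of a run. -/

variable {A : M.Scenario → M.Decision → Set M.Decision} {C : M.Scenario → Set M.Decision}
  {U : M.Scenario → Submodule ℝ M.Decision} {Blk : ℕ → Set M.Scenario} {ε : ℝ}
  {γ μ : M.Scenario → ℕ → ℝ} {s : Trajectory M}

/-- The Kuhn–Tucker set: the triples `(x, x*, v*)` that certify that `(x, v*)` is a solution. -/
def kuhnTucker (A : M.Scenario → M.Decision → Set M.Decision) (C : M.Scenario → Set M.Decision)
    (U : M.Scenario → Submodule ℝ M.Decision) : Set M.Triple :=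
  {z | z 0 ∈ M.nonanticipativity ∧ (∀ ξ, z 1 ξ ∈ U ξ) ∧ z 2 ∈ M.nonanticipativityᗮ ∧
    ∀ ξ, -(z 1 ξ + z 2 ξ) ∈ A ξ (z 0 ξ) ∧ z 1 ξ ∈ normalCone (C ξ) (z 0 ξ)}

lemma isSolution_of_mem_kuhnTucker {z : M.Triple} (hz : z ∈ kuhnTucker A C U) :
    M.IsSolution A C (z 0) (z 2) := by
  obtain ⟨h1, -, h2, h3⟩ := hz
  exact ⟨h1, h2, fun ξ => Set.mem_add.2 ⟨_, (h3 ξ).1, _, (h3 ξ).2, by abel⟩⟩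

lemma kuhnTucker_nonempty
    (hC : ∀ ξ, (C ξ).Nonempty ∧ IsClosed (C ξ) ∧ Convex ℝ (C ξ))
    (hU : ∀ ξ, Set.range (fun y => y - projSet (C ξ) y) ⊆ (U ξ : Set M.Decision))
    (hsol : ∃ x v : M.Policy, M.IsSolution A C x v) : (kuhnTucker A C U).Nonempty := by
  obtain ⟨x, v, hx, hv, h⟩ := hsol
  choose α hα β hβ hαβ using fun ξ => Set.mem_add.1 (h ξ)
  refine ⟨triple x β v, hx, fun ξ => ?_, hv, fun ξ => ⟨?_, hβ ξ⟩⟩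
  · refine hU ξ ⟨x ξ + β ξ, ?_⟩
    change x ξ + β ξ - projSet (C ξ) (x ξ + β ξ) = β ξ
    rw [projSet_eq_of_mem_normalCone (hC ξ).1 (hC ξ).2.1 (hC ξ).2.2 (hβ ξ), add_sub_cancel_left]
  · change -(β ξ + v ξ) ∈ A ξ (x ξ)
    have : -(β ξ + v ξ) = α ξ := by
      rw [neg_add, ← hαβ ξ]; abel
    rw [this]
    exact hα ξ

/-- The pairs `(a n, a* n)` and `(b n, b* n)` of a run come from proximal steps taken at the earlier
times `ν ξ n`, with step sizes `c ξ n` and `e ξ n` and delays of at most `m`. -/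
structure Trajectory.IsDelayed (s : Trajectory M)
    (A : M.Scenario → M.Decision → Set M.Decision) (C : M.Scenario → Set M.Decision)
    (U : M.Scenario → Submodule ℝ M.Decision) (ε : ℝ)
    (ν : M.Scenario → ℕ → ℕ) (m : ℕ) (c e : M.Scenario → ℕ → ℝ) : Prop where
  ν_le : ∀ ξ n, ν ξ n ≤ n
  le_ν : ∀ ξ n, n ≤ ν ξ n + m
  c_mem : ∀ ξ n, c ξ n ∈ Set.Icc ε (1 / ε)
  e_mem : ∀ ξ n, e ξ n ∈ Set.Icc ε (1 / ε)
  as_mem : ∀ ξ n, s.as n ξ ∈ A ξ (s.a n ξ)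
  as_eq : ∀ ξ n, s.as n ξ = (c ξ n)⁻¹ • (s.x (ν ξ n) ξ - s.a n ξ)
    - (s.xs (ν ξ n) ξ + s.vs (ν ξ n) ξ)
  bs_mem : ∀ ξ n, s.bs n ξ ∈ normalCone (C ξ) (s.b n ξ)
  bs_eq : ∀ ξ n, s.bs n ξ = (e ξ n)⁻¹ • (s.x (ν ξ n) ξ - s.b n ξ) - -s.xs (ν ξ n) ξ
  u_eq : ∀ ξ n, s.u n ξ = (U ξ).starProjection (s.b n ξ - s.a n ξ)

/-- Stored values are frozen since the last activation `ν ξ n`, so the activation formulas hold at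
all times with data and step sizes read at `ν ξ n`. -/
lemma Trajectory.IsRun.exists_isDelayed (hrun : s.IsRun A C U Blk ε γ μ)
    (hA : ∀ ξ, IsMaximallyMonotone (A ξ))
    (hC : ∀ ξ, (C ξ).Nonempty ∧ IsClosed (C ξ) ∧ Convex ℝ (C ξ))
    (hBlk_zero : Blk 0 = Set.univ)
    (hBlk_sweep : ∃ m : ℕ, ∀ n, ⋃ j ∈ Set.Icc n (n + m), Blk j = Set.univ)
    (hε : 0 < ε) (hγ : ∀ ξ n, γ ξ n ∈ Set.Icc ε (1 / ε)) (hμ : ∀ ξ n, μ ξ n ∈ Set.Icc ε (1 / ε)) :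
    ∃ ν m c e, s.IsDelayed A C U ε ν m c e := by
  obtain ⟨m, hm⟩ := hBlk_sweep
  have hex : ∀ ξ : M.Scenario, ∃ ν : ℕ → ℕ, ∀ n, ν n ≤ n ∧ n ≤ ν n + m ∧
      ν n ∈ {k | ξ ∈ Blk k} ∧ ∀ i, ν n < i → i ≤ n → i ∉ {k | ξ ∈ Blk k} := by
    intro ξ
    refine exists_last_activation ?_ fun n => ?_
    · change ξ ∈ Blk 0
      rw [hBlk_zero]
      exact Set.mem_univ ξ
    · have h1 : ξ ∈ ⋃ j ∈ Set.Icc n (n + m), Blk j := by rw [hm n]; exact Set.mem_univ ξ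
      simp only [Set.mem_iUnion, exists_prop] at h1
      exact h1
  choose ν hν using hex
  have frozen : ∀ {f : ℕ → M.Policy} (ξ : M.Scenario),
      (∀ n, ξ ∉ Blk (n + 1) → f (n + 1) ξ = f n ξ) → ∀ n, f n ξ = f (ν ξ n) ξ := by
    intro f ξ hf n
    exact eq_of_frozen (S := {k | ξ ∈ Blk k}) (f := fun n => f n ξ) hf (hν ξ n).1 (hν ξ n).2.2.2
  have ha := fun ξ => frozen (f := s.a) ξ fun n hn => (hrun.keep n ξ hn).1
  have has := fun ξ => frozen (f := s.as) ξ fun n hn => (hrun.keep n ξ hn).2.1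
  have hb := fun ξ => frozen (f := s.b) ξ fun n hn => (hrun.keep n ξ hn).2.2.1
  have hbs := fun ξ => frozen (f := s.bs) ξ fun n hn => (hrun.keep n ξ hn).2.2.2.1
  have hu := fun ξ => frozen (f := s.u) ξ fun n hn => (hrun.keep n ξ hn).2.2.2.2
  have hact : ∀ ξ n, ξ ∈ Blk (ν ξ n) := fun ξ n => (hν ξ n).2.2.1
  refine ⟨ν, m, fun ξ n => γ ξ (ν ξ n), fun ξ n => μ ξ (ν ξ n), fun ξ n => (hν ξ n).1,
    fun ξ n => (hν ξ n).2.1, fun ξ n => hγ ξ _, fun ξ n => hμ ξ _, fun ξ n => ?_, fun ξ n => ?_,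
    fun ξ n => ?_, fun ξ n => ?_, fun ξ n => ?_⟩
  · rw [has, ha]
    set k := ν ξ n with hk
    have hpos : 0 < γ ξ k := hε.trans_le (hγ ξ k).1
    have h1 := (hA ξ).resolvent_smul_spec hpos (s.x k ξ - γ ξ k • s.ls k ξ)
    rw [← hrun.a_eq k ξ (hact ξ n)] at h1
    rw [hrun.as_eq k ξ (hact ξ n)]
    convert h1 using 1
    rw [sub_right_comm, smul_sub (γ ξ k)⁻¹ (s.x k ξ - s.a k ξ), inv_smul_smul₀ hpos.ne']
  · rw [has, ha, hrun.as_eq _ ξ (hact ξ n), hrun.ls_eq _ ξ (hact ξ n)]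
  · rw [hbs, hb]
    set k := ν ξ n with hk
    have hpos : 0 < μ ξ k := hε.trans_le (hμ ξ k).1
    have h1 := smul_mem_normalCone (sub_projSet_mem_normalCone (hC ξ).1 (hC ξ).2.1 (hC ξ).2.2
      (s.x k ξ + μ ξ k • s.xs k ξ)) (inv_pos.2 hpos).le
    rw [← hrun.b_eq k ξ (hact ξ n)] at h1
    rw [hrun.bs_eq k ξ (hact ξ n)]
    convert h1 using 1
    rw [add_sub_right_comm, smul_add, inv_smul_smul₀ hpos.ne', add_comm]
  -- Writing `+ x*` as `- -x*` gives both proximal steps the same shape, so the resolvent lemmas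
  -- apply to `b` with `l = -x*`.
  · rw [hbs, hb, hrun.bs_eq _ ξ (hact ξ n), sub_neg_eq_add, add_comm]
  · rw [hu, ha, hb, hrun.u_eq _ ξ (hact ξ n)]

/-! ### Half-space inequality, vanishing residuals and cluster points. -/

section Run

variable {ν : M.Scenario → ℕ → ℕ} {m : ℕ} {c e : M.Scenario → ℕ → ℝ}

/-- Orthogonal projectors are self-adjoint, so they disappear when paired with vectors of their
range; `inner_ts` and `inner_t` use the same fact. -/
lemma Trajectory.IsDelayed.inner_u (hd : s.IsDelayed A C U ε ν m c e) (n : ℕ) {y : M.Policy}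
    (hy : ∀ ξ, y ξ ∈ U ξ) : ⟪s.u n, y⟫_ℝ = ⟪s.b n, y⟫_ℝ - ⟪s.a n, y⟫_ℝ := by
  rw [← inner_sub_left, inner_policy, inner_policy]
  refine Finset.sum_congr rfl fun ξ _ => ?_
  rw [hd.u_eq, Submodule.inner_starProjection_left_eq_right,
    Submodule.starProjection_eq_self_iff.2 (hy ξ)]
  rfl

lemma Trajectory.IsDelayed.u_mem (hd : s.IsDelayed A C U ε ν m c e) (n : ℕ) (ξ : M.Scenario) :
    s.u n ξ ∈ U ξ := by
  rw [hd.u_eq]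
  exact Submodule.starProjection_apply_mem _ _

lemma Trajectory.IsRun.inner_ts (hrun : s.IsRun A C U Blk ε γ μ) (n : ℕ) {y : M.Policy}
    (hy : y ∈ M.nonanticipativity) : ⟪y, s.ts n⟫_ℝ = ⟪y, s.as n⟫_ℝ + ⟪y, s.bs n⟫_ℝ := by
  rw [hrun.ts_eq, ← Submodule.inner_starProjection_left_eq_right,
    Submodule.starProjection_eq_self_iff.2 hy, inner_add_right]

lemma Trajectory.IsRun.inner_t (hrun : s.IsRun A C U Blk ε γ μ) (n : ℕ) {y : M.Policy}
    (hy : y ∈ M.nonanticipativityᗮ) : ⟪s.t n, y⟫_ℝ = -⟪s.a n, y⟫_ℝ := by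
  rw [hrun.t_eq, inner_neg_left, Submodule.inner_starProjection_left_eq_right,
    Submodule.starProjection_eq_self_iff.2 hy]

lemma Trajectory.IsRun.x_mem (hrun : s.IsRun A C U Blk ε γ μ)
    (hx₀ : s.x 0 ∈ M.nonanticipativity) (n : ℕ) : s.x n ∈ M.nonanticipativity := by
  induction n with
  | zero => exact hx₀
  | succ n ih =>
    rw [hrun.x_succ, hrun.ts_eq]
    exact Submodule.sub_mem _ ih
      (Submodule.smul_mem _ _ (Submodule.starProjection_apply_mem _ _))

lemma Trajectory.IsRun.vs_mem (hrun : s.IsRun A C U Blk ε γ μ)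
    (hv₀ : s.vs 0 ∈ M.nonanticipativityᗮ) (n : ℕ) : s.vs n ∈ M.nonanticipativityᗮ := by
  induction n with
  | zero => exact hv₀
  | succ n ih =>
    rw [hrun.vs_succ, hrun.t_eq]
    exact Submodule.sub_mem _ ih (Submodule.smul_mem _ _
      (Submodule.neg_mem _ (Submodule.starProjection_apply_mem _ _)))

lemma Trajectory.IsRun.xs_mem (hrun : s.IsRun A C U Blk ε γ μ)
    (hd : s.IsDelayed A C U ε ν m c e) (hxs₀ : ∀ ξ, s.xs 0 ξ ∈ U ξ) (n : ℕ) (ξ : M.Scenario) :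
    s.xs n ξ ∈ U ξ := by
  induction n with
  | zero => exact hxs₀ ξ
  | succ n ih =>
    rw [hrun.xs_succ]
    exact Submodule.sub_mem _ ih (Submodule.smul_mem _ _ (hd.u_mem n ξ))

/-- The quantity whose positive part determines the length of the `n`-th step. -/
def Trajectory.gap (s : Trajectory M) (n : ℕ) : ℝ :=
  ⟪s.x n, s.ts n⟫_ℝ - ⟪s.a n, s.as n⟫_ℝ + ⟪s.u n, s.xs n⟫_ℝ - ⟪s.b n, s.bs n⟫_ℝ
    + ⟪s.t n, s.vs n⟫_ℝ

/-- The current primal-dual iterate. -/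
def Trajectory.iterate (s : Trajectory M) (n : ℕ) : M.Triple := triple (s.x n) (s.xs n) (s.vs n)

/-- The normal vector of the half-space onto which the `n`-th iterate is projected. -/
def Trajectory.direction (s : Trajectory M) (n : ℕ) : M.Triple := triple (s.ts n) (s.u n) (s.t n)

lemma Trajectory.IsRun.iterate_succ (hrun : s.IsRun A C U Blk ε γ μ) (n : ℕ) :
    s.iterate (n + 1) = s.iterate n - s.θ n • s.direction n := by
  ext i : 1
  fin_cases i
  · exact hrun.x_succ n
  · exact hrun.xs_succ n
  · exact hrun.vs_succ n

lemma Trajectory.IsRun.θ_spec (hrun : s.IsRun A C U Blk ε γ μ) (n : ℕ)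
    (hw : s.direction n ≠ 0) :
    ∃ r ∈ Set.Icc ε (2 - ε), s.θ n = r * max (s.gap n) 0 / ‖s.direction n‖ ^ 2 := by
  have e : ‖s.direction n‖ ^ 2 = s.τ n := by
    rw [norm_sq_triple, hrun.τ_eq]
    rfl
  have hτ : 0 < s.τ n := by
    rw [← e]
    positivity
  refine ⟨s.lam n, hrun.lam_mem n hτ, ?_⟩
  rw [e, hrun.θ_eq n hτ, hrun.κ_eq n hτ]
  rfl

/-- The difference of the two sides is the sum of the monotonicity products of `A` and of the normal
cone: projectors drop out against the components of `z`, the `⟪z 0, z 1⟫` terms cancel, and `z 0 ⟂ z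
2`. -/
lemma Trajectory.IsRun.gap_le (hrun : s.IsRun A C U Blk ε γ μ)
    (hd : s.IsDelayed A C U ε ν m c e) (hA : ∀ ξ, IsMaximallyMonotone (A ξ)) {z : M.Triple} (hz : z ∈ kuhnTucker A C U) (n : ℕ) :
    s.gap n ≤ ⟪s.iterate n - z, s.direction n⟫_ℝ := by
  obtain ⟨h0, h1, h2, h3⟩ := hz
  have hm1 : 0 ≤ ⟪s.a n - z 0, s.as n - -(z 1 + z 2)⟫_ℝ := by
    rw [inner_policy]
    exact Finset.sum_nonneg fun ξ _ => mul_nonneg (M.prob_pos ξ).le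
      ((hA ξ).1 _ _ _ (hd.as_mem ξ n) _ (h3 ξ).1)
  have hm2 : 0 ≤ ⟪s.b n - z 0, s.bs n - z 1⟫_ℝ := by
    rw [inner_policy]
    exact Finset.sum_nonneg fun ξ _ => mul_nonneg (M.prob_pos ξ).le
      (normalCone_monotone _ _ _ _ (hd.bs_mem ξ n) _ (h3 ξ).2)
  have e1 := hrun.inner_ts n h0
  have e2 := hd.inner_u n h1
  have e3 := hrun.inner_t n h2
  have e4 : ⟪z 0, z 2⟫_ℝ = 0 := Submodule.inner_right_of_mem_orthogonal h0 h2
  rw [inner_sub_left, inner_triple, inner_triple]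
  simp only [Trajectory.gap, Trajectory.iterate, Trajectory.direction, triple_zero, triple_one,
    triple_two]
  rw [real_inner_comm (s.u n) (s.xs n), real_inner_comm (s.t n) (s.vs n),
    real_inner_comm (s.u n) (z 1), real_inner_comm (s.t n) (z 2)]
  simp only [sub_neg_eq_add, inner_sub_left, inner_sub_right, inner_add_right] at hm1 hm2
  linarith

/-- The iterates stay in `𝒱`, `U` and `𝒱ᗮ`, so the projectors drop out and the gap decouples over
scenarios. -/
lemma Trajectory.IsRun.gap_eq_sum (hrun : s.IsRun A C U Blk ε γ μ)
    (hd : s.IsDelayed A C U ε ν m c e)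
    (hx₀ : s.x 0 ∈ M.nonanticipativity) (hv₀ : s.vs 0 ∈ M.nonanticipativityᗮ)
    (hxs₀ : ∀ ξ, s.xs 0 ξ ∈ U ξ) (n : ℕ) :
    s.gap n = ∑ ξ : M.Scenario, M.prob ξ *
      (⟪s.x n ξ - s.a n ξ, s.as n ξ + (s.xs n ξ + s.vs n ξ)⟫_ℝ
        + ⟪s.x n ξ - s.b n ξ, s.bs n ξ + -s.xs n ξ⟫_ℝ) := by
  have e1 := hrun.inner_ts n (hrun.x_mem hx₀ n)
  have e2 := hd.inner_u n (hrun.xs_mem hd hxs₀ n)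
  have e3 := hrun.inner_t n (hrun.vs_mem hv₀ n)
  have e4 : ⟪s.x n, s.vs n⟫_ℝ = 0 :=
    Submodule.inner_right_of_mem_orthogonal (hrun.x_mem hx₀ n) (hrun.vs_mem hv₀ n)
  have e5 : s.gap n = ⟪s.x n - s.a n, s.as n + (s.xs n + s.vs n)⟫_ℝ
      + ⟪s.x n - s.b n, s.bs n + -s.xs n⟫_ℝ := by
    simp only [Trajectory.gap, inner_sub_left, inner_add_right, inner_neg_right]
    linarith
  rw [e5, inner_policy, inner_policy, ← Finset.sum_add_distrib]
  simp only [mul_add]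
  rfl

/-- All the proximal points of a delayed run with bounded iterates are bounded. -/
lemma Trajectory.IsDelayed.exists_bound (hd : s.IsDelayed A C U ε ν m c e) (hε : 0 < ε)
    (hA : ∀ ξ, IsMaximallyMonotone (A ξ)) (hZ : (kuhnTucker A C U).Nonempty)
    {B : ℝ} (hx : ∀ n, ‖s.x n‖ ≤ B) (hxs : ∀ n, ‖s.xs n‖ ≤ B) (hvs : ∀ n, ‖s.vs n‖ ≤ B)
    (ξ : M.Scenario) : ∃ K, ∀ n, ‖s.x n ξ‖ ≤ K ∧ ‖s.a n ξ‖ ≤ K ∧ ‖s.as n ξ‖ ≤ K ∧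
      ‖s.b n ξ‖ ≤ K ∧ ‖s.bs n ξ‖ ≤ K := by
  -- A Kuhn–Tucker point supplies the reference graph points, one for `A ξ` and one for the normal
  -- cone.
  obtain ⟨z, -, -, -, hz⟩ := hZ
  obtain ⟨K₁, h1⟩ := exists_eval_bound hx ξ
  obtain ⟨K₂, h2⟩ := exists_eval_bound hxs ξ
  obtain ⟨K₃, h3⟩ := exists_eval_bound hvs ξ
  have p1 := (norm_nonneg _).trans (h1 0)
  have p2 := (norm_nonneg _).trans (h2 0)
  have p3 := (norm_nonneg _).trans (h3 0)
  obtain ⟨K₄, h4⟩ := (hA ξ).1.exists_bound (hz ξ).1 (B := K₁ + K₂ + K₃) hε (hd.c_mem ξ)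
    (fun n => (h1 (ν ξ n)).trans (by linarith))
    (fun n => (norm_add_le _ _).trans (by linarith [h2 (ν ξ n), h3 (ν ξ n)]))
    (hd.as_mem ξ) (hd.as_eq ξ)
  obtain ⟨K₅, h5⟩ := (normalCone_monotone (C ξ)).exists_bound (hz ξ).2 (B := K₁ + K₂ + K₃) hε
    (hd.e_mem ξ) (fun n => (h1 (ν ξ n)).trans (by linarith))
    (fun n => by rw [norm_neg]; exact (h2 (ν ξ n)).trans (by linarith))
    (hd.bs_mem ξ) (hd.bs_eq ξ)
  have p4 := (norm_nonneg _).trans (h4 0).1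
  have p5 := (norm_nonneg _).trans (h5 0).1
  refine ⟨K₁ + K₄ + K₅, fun n => ⟨?_, ?_, ?_, ?_, ?_⟩⟩
  · linarith [h1 n]
  · linarith [(h4 n).1]
  · linarith [(h4 n).2]
  · linarith [(h5 n).1]
  · linarith [(h5 n).2]

lemma Trajectory.IsRun.exists_direction_bound (hrun : s.IsRun A C U Blk ε γ μ)
    (hd : s.IsDelayed A C U ε ν m c e)
    (h : ∀ ξ, ∃ K, ∀ n, ‖s.x n ξ‖ ≤ K ∧ ‖s.a n ξ‖ ≤ K ∧ ‖s.as n ξ‖ ≤ K ∧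
      ‖s.b n ξ‖ ≤ K ∧ ‖s.bs n ξ‖ ≤ K) : ∃ K, ∀ n, ‖s.direction n‖ ^ 2 ≤ K := by
  obtain ⟨B₁, p1, h1⟩ := exists_policy_bound (x := s.a) fun ξ =>
    (h ξ).imp fun K hK n => (hK n).2.1
  obtain ⟨B₂, p2, h2⟩ := exists_policy_bound (x := fun n => s.as n + s.bs n) fun ξ => by
    obtain ⟨K, hK⟩ := h ξ
    exact ⟨K + K, fun n => (norm_add_le (s.as n ξ) (s.bs n ξ)).trans
      (add_le_add (hK n).2.2.1 (hK n).2.2.2.2)⟩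
  obtain ⟨B₃, p3, h3⟩ := exists_policy_bound (x := s.u) fun ξ => by
    obtain ⟨K, hK⟩ := h ξ
    refine ⟨K + K, fun n => ?_⟩
    rw [hd.u_eq]
    exact (Submodule.norm_starProjection_apply_le _ _).trans ((norm_sub_le _ _).trans
      (add_le_add (hK n).2.2.2.1 (hK n).2.1))
  refine ⟨B₂ ^ 2 + B₃ ^ 2 + B₁ ^ 2, fun n => ?_⟩
  rw [norm_sq_triple]
  refine add_le_add (add_le_add ?_ ?_) ?_ <;> refine pow_le_pow_left₀ (norm_nonneg _) ?_ 2
  · change ‖s.ts n‖ ≤ B₂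
    rw [hrun.ts_eq]
    exact (Submodule.norm_starProjection_apply_le _ _).trans (h2 n)
  · exact h3 n
  · change ‖s.t n‖ ≤ B₁
    rw [hrun.t_eq, norm_neg]
    exact (Submodule.norm_starProjection_apply_le _ _).trans (h1 n)

/-- When the steps and the positive parts of the gaps vanish, the proximal points asymptotically
satisfy the Kuhn–Tucker conditions at the iterates. -/
lemma Trajectory.IsRun.tendsto_proximal (hrun : s.IsRun A C U Blk ε γ μ)
    (hd : s.IsDelayed A C U ε ν m c e) (hε : 0 < ε)
    (hx₀ : s.x 0 ∈ M.nonanticipativity) (hv₀ : s.vs 0 ∈ M.nonanticipativityᗮ)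
    (hxs₀ : ∀ ξ, s.xs 0 ξ ∈ U ξ)
    (hstep : Tendsto (fun n => s.iterate (n + 1) - s.iterate n) atTop (𝓝 0))
    (hgap : Tendsto (fun n => max (s.gap n) 0) atTop (𝓝 0))
    (hbd : ∀ ξ, ∃ K, ∀ n, ‖s.x n ξ‖ ≤ K ∧ ‖s.a n ξ‖ ≤ K ∧ ‖s.as n ξ‖ ≤ K ∧
      ‖s.b n ξ‖ ≤ K ∧ ‖s.bs n ξ‖ ≤ K) (ξ : M.Scenario) :
    (Tendsto (fun n => s.a n ξ - s.x n ξ) atTop (𝓝 0) ∧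
      Tendsto (fun n => s.as n ξ + (s.xs n ξ + s.vs n ξ)) atTop (𝓝 0)) ∧
    (Tendsto (fun n => s.b n ξ - s.x n ξ) atTop (𝓝 0) ∧
      Tendsto (fun n => s.bs n ξ + -s.xs n ξ) atTop (𝓝 0)) := by
  have hx : ∀ ξ, Tendsto (fun n => s.x (ν ξ n) ξ - s.x n ξ) atTop (𝓝 0) := fun ξ =>
    tendsto_delay_sub (x := fun n => s.x n ξ) (tendsto_eval (tendsto_triple_apply hstep 0) ξ)
      (hd.ν_le ξ) (hd.le_ν ξ)
  have hxs : ∀ ξ, Tendsto (fun n => s.xs (ν ξ n) ξ - s.xs n ξ) atTop (𝓝 0) := fun ξ =>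
    tendsto_delay_sub (x := fun n => s.xs n ξ) (tendsto_eval (tendsto_triple_apply hstep 1) ξ)
      (hd.ν_le ξ) (hd.le_ν ξ)
  have hvs : ∀ ξ, Tendsto (fun n => s.vs (ν ξ n) ξ - s.vs n ξ) atTop (𝓝 0) := fun ξ =>
    tendsto_delay_sub (x := fun n => s.vs n ξ) (tendsto_eval (tendsto_triple_apply hstep 2) ξ)
      (hd.ν_le ξ) (hd.le_ν ξ)
  have hl : ∀ ξ, Tendsto (fun n => (s.xs (ν ξ n) ξ + s.vs (ν ξ n) ξ) - (s.xs n ξ + s.vs n ξ))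
      atTop (𝓝 0) := by
    intro ξ
    have h1 := (hxs ξ).add (hvs ξ)
    rw [add_zero] at h1
    exact h1.congr fun n => by abel
  have hxs' : ∀ ξ, Tendsto (fun n => -s.xs (ν ξ n) ξ - -s.xs n ξ) atTop (𝓝 0) := by
    intro ξ
    have h1 := (hxs ξ).neg
    rw [neg_zero] at h1
    exact h1.congr fun n => by abel
  let ra : M.Scenario → ℕ → ℝ := fun ξ n => (c ξ n)⁻¹ * ‖s.x (ν ξ n) ξ - s.a n ξ‖ ^ 2
  let rb : M.Scenario → ℕ → ℝ := fun ξ n => (e ξ n)⁻¹ * ‖s.x (ν ξ n) ξ - s.b n ξ‖ ^ 2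
  have hra : ∀ ξ n, 0 ≤ ra ξ n := fun ξ n =>
    mul_nonneg (inv_pos.2 (hε.trans_le (hd.c_mem ξ n).1)).le (sq_nonneg _)
  have hrb : ∀ ξ n, 0 ≤ rb ξ n := fun ξ n =>
    mul_nonneg (inv_pos.2 (hε.trans_le (hd.e_mem ξ n).1)).le (sq_nonneg _)
  have hdiff : Tendsto (fun n => s.gap n - ∑ ξ : M.Scenario, M.prob ξ * (ra ξ n + rb ξ n))
      atTop (𝓝 0) := by
    have h1 : Tendsto (fun n => ∑ ξ : M.Scenario, M.prob ξ *
        ((⟪s.x n ξ - s.a n ξ, s.as n ξ + (s.xs n ξ + s.vs n ξ)⟫_ℝ - ra ξ n)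
          + (⟪s.x n ξ - s.b n ξ, s.bs n ξ + -s.xs n ξ⟫_ℝ - rb ξ n))) atTop
        (𝓝 (∑ ξ : M.Scenario, M.prob ξ * (0 + 0))) := by
      refine tendsto_finsetSum _ fun ξ _ => (Tendsto.add ?_ ?_).const_mul _
      · obtain ⟨K, hK⟩ := hbd ξ
        exact tendsto_inner_sub_residual hε (hd.c_mem ξ) (fun n => (hK n).1)
          (fun n => (hK (ν ξ n)).1) (fun n => (hK n).2.1) (hd.as_eq ξ) (hx ξ) (hl ξ)
      · obtain ⟨K, hK⟩ := hbd ξ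
        exact tendsto_inner_sub_residual hε (hd.e_mem ξ) (fun n => (hK n).1)
          (fun n => (hK (ν ξ n)).1) (fun n => (hK n).2.2.2.1) (hd.bs_eq ξ) (hx ξ) (hxs' ξ)
    simp only [add_zero, mul_zero, Finset.sum_const_zero] at h1
    refine h1.congr fun n => ?_
    rw [hrun.gap_eq_sum hd hx₀ hv₀ hxs₀, ← Finset.sum_sub_distrib]
    exact Finset.sum_congr rfl fun ξ _ => by ring
  -- The residual sum is nonnegative and at most `max gap 0` minus the vanishing difference, so
  -- control of the positive part of the gap is enough.
  have hsum : Tendsto (fun n => ∑ ξ : M.Scenario, M.prob ξ * (ra ξ n + rb ξ n)) atTop (𝓝 0) := by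
    have h1 := hgap.sub hdiff
    rw [sub_zero] at h1
    refine squeeze_zero (fun n => Finset.sum_nonneg fun ξ _ =>
      mul_nonneg (M.prob_pos ξ).le (add_nonneg (hra ξ n) (hrb ξ n))) (fun n => ?_) h1
    linarith [le_max_left (s.gap n) 0]
  have hr : Tendsto (fun n => ra ξ n + rb ξ n) atTop (𝓝 0) := by
    have h1 := hsum.const_mul (M.prob ξ)⁻¹
    rw [mul_zero] at h1
    refine squeeze_zero (fun n => add_nonneg (hra ξ n) (hrb ξ n)) (fun n => ?_) h1
    rw [← div_eq_inv_mul, le_div_iff₀' (M.prob_pos ξ)]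
    exact Finset.single_le_sum (f := fun ξ => M.prob ξ * (ra ξ n + rb ξ n))
      (fun ξ _ => mul_nonneg (M.prob_pos ξ).le (add_nonneg (hra ξ n) (hrb ξ n)))
      (Finset.mem_univ ξ)
  exact ⟨tendsto_of_residual hε (hd.c_mem ξ) (hd.as_eq ξ) (hx ξ) (hl ξ)
      (squeeze_zero (hra ξ) (fun n => le_add_of_nonneg_right (hrb ξ n)) hr),
    tendsto_of_residual hε (hd.e_mem ξ) (hd.bs_eq ξ) (hx ξ) (hxs' ξ)
      (squeeze_zero (hrb ξ) (fun n => le_add_of_nonneg_left (hra ξ n)) hr)⟩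

/-- Along `φ`, `(a, a*)` and `(b, b*)` converge to the pairs required of `z`; graphs and subspaces
are closed. -/
lemma Trajectory.IsRun.cluster_mem_kuhnTucker (hrun : s.IsRun A C U Blk ε γ μ)
    (hd : s.IsDelayed A C U ε ν m c e) (hA : ∀ ξ, IsMaximallyMonotone (A ξ))
    (hC : ∀ ξ, IsClosed (C ξ))
    (hx₀ : s.x 0 ∈ M.nonanticipativity) (hv₀ : s.vs 0 ∈ M.nonanticipativityᗮ)
    (hxs₀ : ∀ ξ, s.xs 0 ξ ∈ U ξ)
    (hprox : ∀ ξ, (Tendsto (fun n => s.a n ξ - s.x n ξ) atTop (𝓝 0) ∧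
      Tendsto (fun n => s.as n ξ + (s.xs n ξ + s.vs n ξ)) atTop (𝓝 0)) ∧
      (Tendsto (fun n => s.b n ξ - s.x n ξ) atTop (𝓝 0) ∧
        Tendsto (fun n => s.bs n ξ + -s.xs n ξ) atTop (𝓝 0)))
    {φ : ℕ → ℕ} (hφ : StrictMono φ) {z : M.Triple}
    (hz : Tendsto (s.iterate ∘ φ) atTop (𝓝 z)) : z ∈ kuhnTucker A C U := by
  have h0 : Tendsto (fun n => s.x (φ n)) atTop (𝓝 (z 0)) := tendsto_triple_apply hz 0
  have h1 : Tendsto (fun n => s.xs (φ n)) atTop (𝓝 (z 1)) := tendsto_triple_apply hz 1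
  have h2 : Tendsto (fun n => s.vs (φ n)) atTop (𝓝 (z 2)) := tendsto_triple_apply hz 2
  refine ⟨?_, fun ξ => ?_, ?_, fun ξ => ?_⟩
  · exact (Submodule.closed_of_finiteDimensional _).mem_of_tendsto h0
      (Eventually.of_forall fun n => hrun.x_mem hx₀ _)
  · exact (Submodule.closed_of_finiteDimensional (U ξ)).mem_of_tendsto (tendsto_eval h1 ξ)
      (Eventually.of_forall fun n => hrun.xs_mem hd hxs₀ _ ξ)
  · exact (Submodule.closed_of_finiteDimensional _).mem_of_tendsto h2
      (Eventually.of_forall fun n => hrun.vs_mem hv₀ _)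
  · obtain ⟨⟨ha, has⟩, hb, hbs⟩ := hprox ξ
    have hφ' := hφ.tendsto_atTop
    have e0 := tendsto_eval h0 ξ
    have e1 := tendsto_eval h1 ξ
    have e2 := tendsto_eval h2 ξ
    have ka : Tendsto (fun n => s.a (φ n) ξ) atTop (𝓝 (z 0 ξ)) := by
      simpa using (ha.comp hφ').add e0
    have kas : Tendsto (fun n => s.as (φ n) ξ) atTop (𝓝 (-(z 1 ξ + z 2 ξ))) := by
      simpa using (has.comp hφ').sub (e1.add e2)
    have kb : Tendsto (fun n => s.b (φ n) ξ) atTop (𝓝 (z 0 ξ)) := by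
      simpa using (hb.comp hφ').add e0
    have kbs : Tendsto (fun n => s.bs (φ n) ξ) atTop (𝓝 (z 1 ξ)) := by
      simpa using (hbs.comp hφ').add e1
    exact ⟨(hA ξ).mem_of_tendsto ka kas fun n => hd.as_mem ξ _,
      mem_normalCone_of_tendsto (hC ξ) kb kbs fun n => hd.bs_mem ξ _⟩

end Run

end DecisionModel

end StochEq

end

/-! ### The convergence theorem. -/

theorem theorem1 (M : StochEq.DecisionModel)
    (A : M.Scenario → M.Decision → Set M.Decision)
    (hA : ∀ ξ, StochEq.IsMaximallyMonotone (A ξ))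
    (C : M.Scenario → Set M.Decision)
    (hC : ∀ ξ, (C ξ).Nonempty ∧ IsClosed (C ξ) ∧ Convex ℝ (C ξ))
    (hsol : ∃ x v : M.Policy, M.IsSolution A C x v)
    (Blk : ℕ → Set M.Scenario)
    (hBlk : ∀ n, (Blk n).Nonempty)
    (hBlk_zero : Blk 0 = Set.univ)
    (hBlk_sweep : ∃ m : ℕ, ∀ n, ⋃ j ∈ Set.Icc n (n + m), Blk j = Set.univ)
    (ε : ℝ) (hε : ε ∈ Set.Ioo (0 : ℝ) 1)
    (γ μ : M.Scenario → ℕ → ℝ)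
    (hγ : ∀ ξ n, γ ξ n ∈ Set.Icc ε (1 / ε))
    (hμ : ∀ ξ n, μ ξ n ∈ Set.Icc ε (1 / ε))
    (U : M.Scenario → Submodule ℝ M.Decision)
    (hU : ∀ ξ, Set.range (fun y => y - StochEq.projSet (C ξ) y) ⊆ (U ξ : Set M.Decision))
    (s : StochEq.DecisionModel.Trajectory M)
    (hx₀ : s.x 0 ∈ M.nonanticipativity)
    (hv₀ : s.vs 0 ∈ M.nonanticipativityᗮ)
    (hxs₀ : ∀ ξ, s.xs 0 ξ ∈ U ξ)
    (hrun : s.IsRun A C U Blk ε γ μ) :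
    (∃ xbar vbar : M.Policy, M.IsSolution A C xbar vbar ∧
        Tendsto s.x atTop (𝓝 xbar) ∧ Tendsto s.vs atTop (𝓝 vbar)) ∧
      ∀ n, s.x n ∈ M.nonanticipativity ∧ s.vs n ∈ M.nonanticipativityᗮ := by
  obtain ⟨ν, m, c, e, hd⟩ := hrun.exists_isDelayed hA hC hBlk_zero hBlk_sweep hε.1 hγ hμ
  have hZ := StochEq.DecisionModel.kuhnTucker_nonempty hC hU hsol
  have hgap := fun z (hz : z ∈ StochEq.DecisionModel.kuhnTucker A C U) => hrun.gap_le hd hA hz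
  have hanti := fun z hz =>
    StochEq.fejer_antitone hε.1 hrun.θ_spec hrun.iterate_succ (hgap z hz)
  obtain ⟨z₀, hz₀⟩ := hZ
  obtain ⟨B, hB⟩ := StochEq.exists_norm_le_of_antitone (hanti z₀ hz₀)
  have hcomp := fun i n => (PiLp.norm_apply_le (s.iterate n) i).trans (hB n)
  have hbd := hd.exists_bound hε.1 hA ⟨z₀, hz₀⟩ (hcomp 0) (hcomp 1) (hcomp 2)
  obtain ⟨K, hK⟩ := hrun.exists_direction_bound hd hbd
  have hprox := hrun.tendsto_proximal hd hε.1 hx₀ hv₀ hxs₀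
    (StochEq.tendsto_fejer_step hε.1 hrun.θ_spec hrun.iterate_succ (hgap z₀ hz₀))
    (StochEq.tendsto_fejer_max hε.1 hrun.θ_spec hrun.iterate_succ (hgap z₀ hz₀) hK) hbd
  obtain ⟨z, hz, hlim⟩ := StochEq.exists_tendsto_of_fejer ⟨z₀, hz₀⟩ hanti fun φ hφ z h =>
    hrun.cluster_mem_kuhnTucker hd hA (fun ξ => (hC ξ).2.1) hx₀ hv₀ hxs₀ hprox hφ h
  exact ⟨⟨z 0, z 2, StochEq.DecisionModel.isSolution_of_mem_kuhnTucker hz,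
    StochEq.DecisionModel.tendsto_triple_apply hlim 0,
    StochEq.DecisionModel.tendsto_triple_apply hlim 2⟩,
    fun n => ⟨hrun.x_mem hx₀ n, hrun.vs_mem hv₀ n⟩⟩
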